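/- **Setting.** Let $\mathcal P^r=\{I,X,Y,Z\}^{r}$ be the $r$-qubit Pauli operators modulo phase, $\langle P,Q\rangle\in\{0,1\}$ be $0$ iff $P,Q$ commute, and $pt(P)\in\mathbb Z_2^{r}$ the weight pattern of $P$ ($0$ where $P$ acts as the identity, $1$ elsewhere). Fix $m,n\ge 0$, a Clifford gate $G$ on $m+n$ qubits ($m$ unmeasured, $n$ ancilla qubits), and a finite family of Clifford gates $G_i$ on the same qubits. Write $\mathcal G(A)=GAG^\dagger$. A *noise model* $\mathcal N$ consists of: an initial density matrix $\rho$; for each $i$ a Pauli channel $\Lambda_i$, the noisy gate being $\Lambda_i\mathcal G_i$; a probability distribution $p_{a,b}^P$ ($a,b\in\mathbb Z_2^n$, $P\in\mathcal P^m$), the noisy mid-circuit measurement (MCM) with readout $k\in\mathbb Z_2^n$ being $$\mathcal T_k(A)=\sum_{a,b,P}p_{a,b}^P\,(P\otimes|k+b\rangle\langle k+a|)\,GAG^\dagger\,(P\otimes|k+a\rangle\langle k+b|);$$ and a Pauli channel $\Lambda_M$ that precedes the terminating measurement. All Pauli error rates (of $\Lambda_i$, $\Lambda_M$ and the MCM)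 are strictly positive. All Pauli fidelities are strictly positive, where the fidelities of a Pauli channel with error rates $p^P$ are $\lambda^Q=\sum_P(-1)^{\langle P,Q\rangle}p^P$ and those of the MCM are $\lambda_{x,y}^Q=\sum_{a,b,P}(-1)^{a\cdot x+b\cdot y+\langle P,Q\rangle}p_{a,b}^P$. The fidelities of $\Lambda_M$ depend only on the weight pattern. For every weight pattern $v\in\mathbb Z_2^{m+n}$ there is a Pauli operator $P$ with $pt(P)=v$ and $\operatorname{Tr}(P\rho)\neq0$. An *experiment* prepares $\rho$, applies a finite sequence of noiseless layers of arbitrary single-qubit unitaries, noisy gates $\Lambda_i\mathcal G_i$ and noisy MCMs, and then measures an arbitrary finite-outcome POVM after $\Lambda_M$. Two noise models are *indistinguishable* if every experiment has the same joint distribution of MCM readouts and terminating outcome under both. A real function $f$ of noise models is *learnable* if $f(\mathcal N_1)=f(\mathcal N_2)$ for all indistinguishable $\mathcal N_1,\mathcal N_2$. The *pattern transfer graph* is the directed multigraph with vertex set $\mathbb Z_2^{m+n}$ and one edge $e_{x,y}^Q$ from $pt(\mathcal G^\dagger(Q\otimes Z^x))$ to $pt(Q\otimes Z^y)$ for each $x,y\in\mathbb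 Z_2^n$, $Q\in\mathcal P^m$. Here $0$-chains and $1$-chains are real linear combinations of vertices and of edges. For an edge $e=(u,v)$, $\partial e=v-u$, and for a $0$-chain $\nu$ the coefficient of $\delta\nu$ at $e$ is $\nu_v-\nu_u$. The cycle space is $Z=\ker\partial$ and the cut space is $U=\operatorname{im}\delta$. A $1$-chain $\mu=\sum\mu_{x,y}^Qe_{x,y}^Q$ is regarded as the function $\mu(\mathcal N)=\sum\mu_{x,y}^Q\log\lambda_{x,y}^Q$ of noise models; $F_L$ is the set of learnable $1$-chains. **Theorem.** 1. $F_L=Z$. 2. Every cut vector gives a gauge transformation. Let $\nu$ be a $0$-chain and $\mathcal N$ a noise model whose initial state $\rho$ is positive definite. For all $\eta>0$ sufficiently close to $1$, let $\mathcal D$ be the invertible linear map with $\mathcal D(P)=\eta^{\nu_{pt(P)}-\nu_0}P$ for all $P\in\mathcal P^{m+n}$. Then conjugation by $\mathcal D$ fixes all layers of single-qubit unitaries, and $\rho\mapsto\mathcal D(\rho)$, $\Lambda_i\mathcal G_i\mapsto\mathcal D\Lambda_i\mathcal G_i\mathcal D^{-1}$, $\mathcal T_k\mapsto\mathcal D\mathcal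 T_k\mathcal D^{-1}$, $\Lambda_M\mapsto\Lambda_M\mathcal D^{-1}$ is again a noise model $\mathcal N'$ (all the assumptions above hold). It is indistinguishable from $\mathcal N$, and for each edge its log Pauli fidelity equals that of $\mathcal N$ plus $(\delta\nu)_e\log\eta$. 3. $F_L$ is orthogonal to $U$. -/

import Mathlib

open scoped ComplexOrder

noncomputable section

namespace MCM

/-! ### Pauli operators, bit strings and Clifford gates -/

/-- The four single-qubit Pauli operators, modulo phase. -/
inductive Pauli1 where
  | I | X | Y | Z
  deriving DecidableEq

instance : Fintype Pauli1 :=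
  ⟨{.I, .X, .Y, .Z}, fun P => by cases P <;> decide⟩

/-- Bit strings indexed by `ι`; they also label the computational basis of the qubits in `ι`. -/
abbrev Bits (ι : Type) : Type := ι → ZMod 2

/-- Operators on the Hilbert space of the qubits in `ι`. -/
abbrev Operator (ι : Type) : Type := Matrix (Bits ι) (Bits ι) ℂ

/-- Pauli operators on the qubits in `ι`, modulo phase. -/
abbrev PauliString (ι : Type) : Type := ι → Pauli1

/-- The matrix of a single-qubit Pauli operator. -/
def Pauli1.mat : Pauli1 → Matrix (ZMod 2) (ZMod 2) ℂ
  | .I => Matrix.of fun s t => if s = t then 1 else 0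
  | .X => Matrix.of fun s t => if s = t then 0 else 1
  | .Y => Matrix.of fun s t => if s = t then 0 else if s = 0 then -Complex.I else Complex.I
  | .Z => Matrix.of fun s t => if s = t then if s = 0 then 1 else -1 else 0

/-- The tensor product of a family of single-qubit matrices. -/
def tensor {ι : Type} [Fintype ι] (u : ι → Matrix (ZMod 2) (ZMod 2) ℂ) : Operator ι :=
  Matrix.of fun s t => ∏ i, u i (s i) (t i)

/-- The matrix of a Pauli operator. -/
def pauliMat {ι : Type} [Fintype ι] (P : PauliString ι) : Operator ι :=
  tensor fun i => (P i).mat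

/-- `0` if two single-qubit Pauli operators commute and `1` otherwise. -/
def Pauli1.inner (P Q : Pauli1) : ZMod 2 :=
  if P = .I ∨ Q = .I ∨ P = Q then 0 else 1

/-- The inner product of Pauli operators: `0` if they commute and `1` otherwise
(see `pauliMat_mul_comm`). -/
def pauliInner {ι : Type} [Fintype ι] (P Q : PauliString ι) : ZMod 2 :=
  ∑ i, (P i).inner (Q i)

/-- The sign `(-1) ^ s` of a bit `s`. -/
def sgn (s : ZMod 2) : ℝ := (-1) ^ s.val

/-- The Pauli weight pattern: `0` where the operator acts as the identity, `1` elsewhere. -/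
def pattern {ι : Type} (P : PauliString ι) : Bits ι :=
  fun i => if P i = .I then 0 else 1

/-- The Pauli operator `Q ⊗ Z ^ x` on `m` unmeasured qubits and `n` ancilla qubits. -/
def withZ {m n : ℕ} (Q : PauliString (Fin m)) (x : Bits (Fin n)) :
    PauliString (Fin m ⊕ Fin n) :=
  Sum.elim Q fun i => if x i = 0 then .I else .Z

/-- Clifford gates: the unitaries that normalize the Pauli group. -/
structure Clifford (ι : Type) [Fintype ι] [DecidableEq ι] where
  /-- the matrix of the gate -/
  U : Operator ι
  unitary : U ∈ Matrix.unitaryGroup (Bits ι) ℂ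
  push : ∀ P : PauliString ι, ∃ Q : PauliString ι,
    U * pauliMat P * U.conjTranspose = pauliMat Q ∨
    U * pauliMat P * U.conjTranspose = -pauliMat Q
  pull : ∀ P : PauliString ι, ∃ Q : PauliString ι,
    U.conjTranspose * pauliMat P * U = pauliMat Q ∨
    U.conjTranspose * pauliMat P * U = -pauliMat Q

/-- The Pauli operator `G† P G`, modulo sign. -/
def Clifford.pullback {ι : Type} [Fintype ι] [DecidableEq ι] (G : Clifford ι)
    (P : PauliString ι) : PauliString ι :=
  (G.pull P).choose

/-- The unitary channel of a Clifford gate. -/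
def Clifford.channel {ι : Type} [Fintype ι] [DecidableEq ι] (G : Clifford ι)
    (A : Operator ι) : Operator ι :=
  G.U * A * G.U.conjTranspose

/-- The channel that applies the single-qubit unitary `u i` to every qubit `i`. -/
def localChannel {ι : Type} [Fintype ι] [DecidableEq ι] (u : ι → Matrix.unitaryGroup (ZMod 2) ℂ)
    (A : Operator ι) : Operator ι :=
  tensor (fun i => (u i : Matrix (ZMod 2) (ZMod 2) ℂ)) * A *
    (tensor fun i => (u i : Matrix (ZMod 2) (ZMod 2) ℂ)).conjTranspose

/-! ### Pauli channels and noisy mid-circuit measurements -/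

/-- The Pauli channel with Pauli error rates `p`. -/
def pauliChannel {ι : Type} [Fintype ι] [DecidableEq ι] (p : PauliString ι → ℝ)
    (A : Operator ι) : Operator ι :=
  ∑ P, (p P : ℂ) • (pauliMat P * A * (pauliMat P).conjTranspose)

/-- The Pauli fidelities of the Pauli channel with error rates `p`. -/
def pauliFidelity {ι : Type} [Fintype ι] [DecidableEq ι] (p : PauliString ι → ℝ)
    (Q : PauliString ι) : ℝ :=
  ∑ P, sgn (pauliInner P Q) * p P

/-- The operator `P ⊗ |k + b⟩⟨k + a|`. -/
def mcmKraus {m n : ℕ} (k a b : Bits (Fin n)) (P : PauliString (Fin m)) :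
    Operator (Fin m ⊕ Fin n) :=
  Matrix.of fun s t => pauliMat P (fun i => s (.inl i)) (fun i => t (.inl i)) *
    (if (fun i => s (.inr i)) = k + b ∧ (fun i => t (.inr i)) = k + a then 1 else 0)

/-- The noisy mid-circuit measurement: the branch with readout `k` of the uniform stochastic
instrument with Pauli error rates `p a b P`, applied after the Clifford gate `G`. -/
def mcmBranch {m n : ℕ} (G : Clifford (Fin m ⊕ Fin n))
    (p : Bits (Fin n) → Bits (Fin n) → PauliString (Fin m) → ℝ) (k : Bits (Fin n))
    (A : Operator (Fin m ⊕ Fin n)) : Operator (Fin m ⊕ Fin n) :=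
  ∑ a, ∑ b, ∑ P,
    (p a b P : ℂ) • (mcmKraus k a b P * G.channel A * (mcmKraus k a b P).conjTranspose)

/-- The Pauli fidelity `λ_{x,y}^Q` of the mid-circuit measurement with error rates `p`. -/
def mcmFidelity {m n : ℕ} (p : Bits (Fin n) → Bits (Fin n) → PauliString (Fin m) → ℝ)
    (x y : Bits (Fin n)) (Q : PauliString (Fin m)) : ℝ :=
  ∑ a, ∑ b, ∑ P, sgn (a ⬝ᵥ x + b ⬝ᵥ y + pauliInner P Q) * p a b P

/-! ### Noise models -/

/-- Noise models for `m` unmeasured qubits, `n` ancilla qubits and multi-qubit Clifford gates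
labelled by `κ`: the unknown initial state, the error rates of the Pauli noise after each gate, of
the mid-circuit measurement, and of the symmetric Pauli noise before the terminating measurement.
Error rates are probability distributions in the interior of the simplex, and all Pauli fidelities
are strictly positive. The initial state has a nonzero component in every weight pattern. -/
structure NoiseModel (m n : ℕ) (κ : Type*) where
  /-- the initial state -/
  ρ : Operator (Fin m ⊕ Fin n)
  /-- Pauli error rates of the multi-qubit gates -/
  gateRate : κ → PauliString (Fin m ⊕ Fin n) → ℝ
  /-- Pauli error rates of the mid-circuit measurement -/
  mcmRate : Bits (Fin n) → Bits (Fin n) → PauliString (Fin m) → ℝ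
  /-- Pauli error rates of the terminating measurement -/
  measRate : PauliString (Fin m ⊕ Fin n) → ℝ
  ρ_pos : ρ.PosSemidef
  ρ_trace : ρ.trace = 1
  ρ_overlap : ∀ v : Bits (Fin m ⊕ Fin n), ∃ P : PauliString (Fin m ⊕ Fin n),
    pattern P = v ∧ (pauliMat P * ρ).trace ≠ 0
  gateRate_pos : ∀ i P, 0 < gateRate i P
  gateRate_sum : ∀ i, ∑ P, gateRate i P = 1
  gateFidelity_pos : ∀ i Q, 0 < pauliFidelity (gateRate i) Q
  mcmRate_pos : ∀ a b P, 0 < mcmRate a b P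
  mcmRate_sum : ∑ a, ∑ b, ∑ P, mcmRate a b P = 1
  mcmFidelity_pos : ∀ x y Q, 0 < mcmFidelity mcmRate x y Q
  measRate_pos : ∀ P, 0 < measRate P
  measRate_sum : ∑ P, measRate P = 1
  measFidelity_pos : ∀ Q, 0 < pauliFidelity measRate Q
  measFidelity_symm : ∀ P Q, pattern P = pattern Q →
    pauliFidelity measRate P = pauliFidelity measRate Q

/-! ### Experiments and learnability -/

/-- The gates available between mid-circuit measurements. -/
inductive Gate (m n : ℕ) (κ : Type*) where
  /-- a noiseless layer of arbitrary single-qubit gates -/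
  | oneQubit (u : Fin m ⊕ Fin n → Matrix.unitaryGroup (ZMod 2) ℂ)
  /-- a noisy multi-qubit Clifford gate -/
  | multiQubit (i : κ)

/-- An experiment: gates `first`, then `depth` mid-circuit measurements, the `i`-th of which is
followed by the gates `layer i`, then a terminating measurement of a POVM. -/
structure Experiment (m n : ℕ) (κ : Type*) where
  depth : ℕ
  first : List (Gate m n κ)
  layer : Fin depth → List (Gate m n κ)
  outcomes : ℕ
  povm : Fin outcomes → Operator (Fin m ⊕ Fin n)
  povm_pos : ∀ j, (povm j).PosSemidef
  povm_sum : ∑ j, povm j = 1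

section Dynamics

variable {m n : ℕ} {κ : Type*}

/-- The noisy implementation of the multi-qubit gate `i`: the ideal gate, then Pauli noise. -/
def NoiseModel.noisyGate (gates : κ → Clifford (Fin m ⊕ Fin n)) (N : NoiseModel m n κ) (i : κ)
    (A : Operator (Fin m ⊕ Fin n)) : Operator (Fin m ⊕ Fin n) :=
  pauliChannel (N.gateRate i) ((gates i).channel A)

/-- The action of a gate under a noise model. -/
def NoiseModel.applyGate (gates : κ → Clifford (Fin m ⊕ Fin n)) (N : NoiseModel m n κ)
    (A : Operator (Fin m ⊕ Fin n)) : Gate m n κ → Operator (Fin m ⊕ Fin n)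
  | .oneQubit u => localChannel u A
  | .multiQubit i => N.noisyGate gates i A

/-- The action of a sequence of gates, the head of the list first. -/
def NoiseModel.applyGates (gates : κ → Clifford (Fin m ⊕ Fin n)) (N : NoiseModel m n κ)
    (A : Operator (Fin m ⊕ Fin n)) (C : List (Gate m n κ)) : Operator (Fin m ⊕ Fin n) :=
  C.foldl (N.applyGate gates) A

/-- The unnormalized state after rounds `(k, C)`, the head of the list first, each a mid-circuit
measurement with readout `k` followed by the gates `C`. -/
def NoiseModel.run (G : Clifford (Fin m ⊕ Fin n)) (gates : κ → Clifford (Fin m ⊕ Fin n))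
    (N : NoiseModel m n κ) (A : Operator (Fin m ⊕ Fin n))
    (rounds : List (Bits (Fin n) × List (Gate m n κ))) : Operator (Fin m ⊕ Fin n) :=
  rounds.foldl (fun B r => N.applyGates gates (mcmBranch G N.mcmRate r.1 B) r.2) A

/-- The probability that the mid-circuit measurements read `k` and the terminating measurement
reads `j`. -/
def outcomeProb (G : Clifford (Fin m ⊕ Fin n)) (gates : κ → Clifford (Fin m ⊕ Fin n))
    (N : NoiseModel m n κ) (E : Experiment m n κ) (k : Fin E.depth → Bits (Fin n))
    (j : Fin E.outcomes) : ℝ :=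
  (E.povm j * pauliChannel N.measRate
    (N.run G gates (N.applyGates gates N.ρ E.first)
      (List.ofFn fun i => (k i, E.layer i)))).trace.re

/-- Noise models are indistinguishable if all experiments have the same outcome distribution. -/
def Indistinguishable (G : Clifford (Fin m ⊕ Fin n)) (gates : κ → Clifford (Fin m ⊕ Fin n))
    (N₁ N₂ : NoiseModel m n κ) : Prop :=
  ∀ (E : Experiment m n κ) (k : Fin E.depth → Bits (Fin n)) (j : Fin E.outcomes),
    outcomeProb G gates N₁ E k j = outcomeProb G gates N₂ E k j

/-- A function of noise models is learnable if it agrees on indistinguishable noise models. -/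
def Learnable (G : Clifford (Fin m ⊕ Fin n)) (gates : κ → Clifford (Fin m ⊕ Fin n))
    (f : NoiseModel m n κ → ℝ) : Prop :=
  ∀ N₁ N₂, Indistinguishable G gates N₁ N₂ → f N₁ = f N₂

end Dynamics

/-! ### The pattern transfer graph -/

/-- The edges `e_{x,y}^Q` of the pattern transfer graph, as triples `(x, y, Q)`. The graph is a
directed multigraph whose vertices are the weight patterns `Bits (Fin m ⊕ Fin n)`. -/
abbrev Edge (m n : ℕ) : Type := Bits (Fin n) × Bits (Fin n) × PauliString (Fin m)

section Graph

variable {m n : ℕ}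

/-- The start point of an edge. -/
def edgeSrc (G : Clifford (Fin m ⊕ Fin n)) (e : Edge m n) : Bits (Fin m ⊕ Fin n) :=
  pattern (G.pullback (withZ e.2.2 e.1))

/-- The end point of an edge. -/
def edgeTgt (e : Edge m n) : Bits (Fin m ⊕ Fin n) :=
  pattern (withZ e.2.2 e.2.1)

/-- The boundary operator from `1`-chains to `0`-chains, with `∂ (u, v) = v - u`. -/
def boundary (G : Clifford (Fin m ⊕ Fin n)) :
    (Edge m n → ℝ) →ₗ[ℝ] (Bits (Fin m ⊕ Fin n) → ℝ) :=
  ∑ e : Edge m n, (LinearMap.proj (R := ℝ) (φ := fun _ : Edge m n => ℝ) e).smulRight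
    (Pi.single (edgeTgt e) 1 - Pi.single (edgeSrc G e) 1 : Bits (Fin m ⊕ Fin n) → ℝ)

/-- The coboundary operator from `0`-chains to `1`-chains: the coefficient of `δ ν` on an edge is
the coefficient of `ν` on its end point minus that on its start point (`0` on loops). -/
def coboundary (G : Clifford (Fin m ⊕ Fin n)) :
    (Bits (Fin m ⊕ Fin n) → ℝ) →ₗ[ℝ] (Edge m n → ℝ) :=
  LinearMap.pi fun e =>
    LinearMap.proj (R := ℝ) (φ := fun _ : Bits (Fin m ⊕ Fin n) => ℝ) (edgeTgt e) -
      LinearMap.proj (edgeSrc G e)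

/-- The cycle space of the pattern transfer graph. -/
def cycleSpace (G : Clifford (Fin m ⊕ Fin n)) : Submodule ℝ (Edge m n → ℝ) :=
  LinearMap.ker (boundary G)

/-- The cut space of the pattern transfer graph. -/
def cutSpace (G : Clifford (Fin m ⊕ Fin n)) : Submodule ℝ (Edge m n → ℝ) :=
  LinearMap.range (coboundary G)

/-- The logarithm of the Pauli fidelity that corresponds to an edge. -/
def logFidelity {κ : Type*} (N : NoiseModel m n κ) (e : Edge m n) : ℝ :=
  Real.log (mcmFidelity N.mcmRate e.1 e.2.1 e.2.2)

/-- A `1`-chain as a function of noise models. -/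
def chainValue {κ : Type*} (μ : Edge m n → ℝ) (N : NoiseModel m n κ) : ℝ :=
  ∑ e, μ e * logFidelity N e

/-- The set `F_L` of learnable `1`-chains. -/
def learnableChains {κ : Type*} (G : Clifford (Fin m ⊕ Fin n))
    (gates : κ → Clifford (Fin m ⊕ Fin n)) : Set (Edge m n → ℝ) :=
  {μ | Learnable G gates fun N => chainValue μ N}

end Graph

/-! ### Gauge transformations -/

section Gauge

variable {m n : ℕ} {κ : Type*}

/-- The Pauli-diagonal map `P ↦ η ^ (ν (pattern P) - ν 0) • P`, extended linearly through the Pauli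
expansion of an operator. Its inverse is `gaugeMap η (-ν)` (for `η > 0`). -/
def gaugeMap (η : ℝ) (ν : Bits (Fin m ⊕ Fin n) → ℝ) (A : Operator (Fin m ⊕ Fin n)) :
    Operator (Fin m ⊕ Fin n) :=
  ∑ P : PauliString (Fin m ⊕ Fin n),
    (((η ^ (ν (pattern P) - ν 0) : ℝ) : ℂ) * ((pauliMat P * A).trace / 2 ^ (m + n))) • pauliMat P

/-- The noise model `N'` is the transform of `N` under the invertible map `D = gaugeMap η ν`: the
state becomes `D ρ`, every gate and every branch of the mid-circuit measurement is conjugated by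
`D` (which leaves the single-qubit gates noiseless), and the terminating measurement is preceded
by `D⁻¹`. -/
structure IsGaugeTransform (G : Clifford (Fin m ⊕ Fin n)) (gates : κ → Clifford (Fin m ⊕ Fin n))
    (η : ℝ) (ν : Bits (Fin m ⊕ Fin n) → ℝ) (N N' : NoiseModel m n κ) : Prop where
  left_inv : ∀ A : Operator (Fin m ⊕ Fin n), gaugeMap η (-ν) (gaugeMap η ν A) = A
  right_inv : ∀ A : Operator (Fin m ⊕ Fin n), gaugeMap η ν (gaugeMap η (-ν) A) = A
  state : N'.ρ = gaugeMap η ν N.ρ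
  oneQubit : ∀ u (A : Operator (Fin m ⊕ Fin n)),
    localChannel u A = gaugeMap η ν (localChannel u (gaugeMap η (-ν) A))
  multiQubit : ∀ i A,
    N'.noisyGate gates i A = gaugeMap η ν (N.noisyGate gates i (gaugeMap η (-ν) A))
  mcm : ∀ k A,
    mcmBranch G N'.mcmRate k A = gaugeMap η ν (mcmBranch G N.mcmRate k (gaugeMap η (-ν) A))
  meas : ∀ A, pauliChannel N'.measRate A = pauliChannel N.measRate (gaugeMap η (-ν) A)

end Gauge

/-! ### The inner product of Pauli operators records commutation -/

theorem tensor_mul {ι : Type} [Fintype ι] [DecidableEq ι]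
    (u v : ι → Matrix (ZMod 2) (ZMod 2) ℂ) :
    tensor u * tensor v = tensor fun i => u i * v i := by
  ext s t
  simp only [tensor, Matrix.mul_apply, Matrix.of_apply, ← Finset.prod_mul_distrib]
  rw [Finset.prod_univ_sum, Fintype.piFinset_univ]

theorem Pauli1.mat_mul_comm (P Q : Pauli1) :
    P.mat * Q.mat = (sgn (P.inner Q) : ℂ) • (Q.mat * P.mat) := by
  have h1 : (1 : ZMod 2).val = 1 := rfl
  have hsum : ∀ f : ZMod 2 → ℂ, ∑ s, f s = f 0 + f 1 := fun f => Fin.sum_univ_two f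
  have hbit : ∀ s : ZMod 2, s = 0 ∨ s = 1 := by decide
  ext i j
  rcases hbit i with rfl | rfl <;> rcases hbit j with rfl | rfl <;> cases P <;> cases Q <;>
    simp [Pauli1.mat, sgn, Pauli1.inner, h1, Matrix.mul_apply, hsum]

theorem sgn_add (s t : ZMod 2) : sgn (s + t) = sgn s * sgn t := by
  have h : ∀ s t : ZMod 2, (-1 : ℤ) ^ (s + t).val = (-1) ^ s.val * (-1) ^ t.val := by decide
  have := congrArg (Int.cast : ℤ → ℝ) (h s t)
  simpa [sgn] using this

theorem sgn_sum {ι : Type} (S : Finset ι) (f : ι → ZMod 2) :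
    sgn (∑ i ∈ S, f i) = ∏ i ∈ S, sgn (f i) := by
  classical
  induction S using Finset.induction_on with
  | empty => simp [sgn]
  | insert a S ha ih => rw [Finset.sum_insert ha, Finset.prod_insert ha, sgn_add, ih]

theorem pauliMat_mul_comm {ι : Type} [Fintype ι] [DecidableEq ι] (P Q : PauliString ι) :
    pauliMat P * pauliMat Q = (sgn (pauliInner P Q) : ℂ) • (pauliMat Q * pauliMat P) := by
  simp only [pauliMat, tensor_mul, Pauli1.mat_mul_comm (P _) (Q _)]
  ext s t
  simp [tensor, pauliInner, sgn_sum, Finset.prod_mul_distrib]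

end MCM

end

/-!
# Learnable chains of the pattern transfer graph

In the Pauli basis every channel of the model acts by scalars. The Pauli channels multiply each
coefficient `tr (P A)` by a fidelity, single-qubit unitaries preserve weight patterns, and the
branch of the mid-circuit measurement with readout `k` sends the component `G†(Q ⊗ Z ^ x)` to the
components `Q ⊗ Z ^ y` with the coefficients `± λ_{x,y}^Q / 2 ^ n`
(`trace_withZ_mul_mcmBranch`). The sign is a character of `k`, so a Fourier transform over the
readouts isolates a single fidelity (`sum_sgn_mul_trace_mcmBranch`).

*Cuts are gauge directions.* The map `D = gaugeMap η ν` is scalar on each weight pattern, so it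
commutes with single-qubit unitaries (`localChannel_gaugeMap`). Conjugation by `D` multiplies
the fidelity of an edge by `η ^ (δν)_e`, and acts similarly on the gates and on the terminating
measurement (`IsGaugeTransform.of_fidelity`). Error rates depend on fidelities through the inverse
Fourier transform, which is continuous, so they stay positive for `η` near `1`
(`IsFourierKernel.eventually_exists_rates`), as does the initial state (`eventually_posDef`). In
every experiment the factors `D` and `D⁻¹` cancel, so the two models are indistinguishable.
A learnable chain is therefore orthogonal to all cuts, that is, a cycle.

*Cycles are learnable.* Measuring a Pauli operator `P` at once reveals `tr (P ρ) λ_M(P)`. Rotating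
`P` by single-qubit gates to the source of an edge `e`, performing one mid-circuit measurement and
measuring the Pauli operator at its target reveals `tr (P ρ) λ_e λ_M(target)`, up to a sign that is
the same in all models. As `λ_M` depends only on the pattern, the ratio of the two shows that the
vectors of log fidelities of two indistinguishable models differ by the coboundary of a function
of patterns (`Indistinguishable.exists_coboundary`), on which a cycle vanishes because `∂` and `δ`
are adjoint (`sum_mul_coboundary`).
-/

namespace MCM

open scoped Matrix

/-! ### Fourier inversion of error rates and fidelities -/

/-- A real symmetric kernel with orthogonal rows, such as the table of the characters of an
elementary abelian 2-group; the index `o` labels the trivial character. It relates error rates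
and fidelities. -/
structure IsFourierKernel {α : Type*} [Fintype α] [DecidableEq α] (χ : α → α → ℝ) (o : α) :
    Prop where
  symm : ∀ a b, χ a b = χ b a
  base : ∀ a, χ a o = 1
  orth : ∀ a b, ∑ c, χ a c * χ c b = if a = b then (Fintype.card α : ℝ) else 0

/-- The fidelities of the error rates `p` with respect to the kernel `χ`. -/
def fourier {α : Type*} [Fintype α] (χ : α → α → ℝ) (p : α → ℝ) (b : α) : ℝ :=
  ∑ a, χ a b * p a

namespace IsFourierKernel

variable {α β : Type*} [Fintype α] [DecidableEq α] [Fintype β] [DecidableEq β]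
  {χ : α → α → ℝ} {o : α} {ψ : β → β → ℝ} {o' : β}

theorem prod (hχ : IsFourierKernel χ o) (hψ : IsFourierKernel ψ o') :
    IsFourierKernel (fun a b : α × β => χ a.1 b.1 * ψ a.2 b.2) (o, o') where
  symm a b := by simp only [hχ.symm a.1, hψ.symm a.2]
  base a := by simp [hχ.base, hψ.base]
  orth a b := by
    have h : ∑ c : α × β, χ a.1 c.1 * ψ a.2 c.2 * (χ c.1 b.1 * ψ c.2 b.2) =
        (∑ c, χ a.1 c * χ c b.1) * ∑ c, ψ a.2 c * ψ c b.2 := by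
      rw [Finset.sum_mul_sum, Fintype.sum_prod_type]
      exact Finset.sum_congr rfl fun _ _ => Finset.sum_congr rfl fun _ _ => by ring
    rw [h, hχ.orth, hψ.orth]
    by_cases h1 : a.1 = b.1 <;> by_cases h2 : a.2 = b.2 <;> simp [Prod.ext_iff, h1, h2]

theorem pi {ι : Type*} [Fintype ι] [DecidableEq ι] (hχ : IsFourierKernel χ o) :
    IsFourierKernel (fun a b : ι → α => ∏ i, χ (a i) (b i)) (fun _ => o) where
  symm a b := by simp only [hχ.symm (a _)]
  base a := by simp [hχ.base]
  orth a b := by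
    have h : ∑ c : ι → α, (∏ i, χ (a i) (c i)) * ∏ i, χ (c i) (b i) =
        ∏ i, ∑ c, χ (a i) c * χ c (b i) := by
      rw [Finset.prod_univ_sum, Fintype.piFinset_univ]
      simp only [Finset.prod_mul_distrib]
    simp only [h, hχ.orth]
    by_cases hab : a = b
    · simp [hab]
    · obtain ⟨i, hi⟩ := Function.ne_iff.mp hab
      rw [if_neg hab]
      exact Finset.prod_eq_zero (Finset.mem_univ i) (if_neg hi)

theorem fourier_base (hχ : IsFourierKernel χ o) (p : α → ℝ) : fourier χ p o = ∑ a, p a := by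
  simp [fourier, hχ.base]

theorem card_ne_zero (_ : IsFourierKernel χ o) : (Fintype.card α : ℝ) ≠ 0 :=
  Nat.cast_ne_zero.mpr (@Fintype.card_ne_zero α _ ⟨o⟩)

theorem fourier_fourier (hχ : IsFourierKernel χ o) (p : α → ℝ) (b : α) :
    fourier χ (fourier χ p) b = Fintype.card α * p b := by
  simp only [fourier, Finset.mul_sum]
  rw [Finset.sum_comm]
  have h : ∀ a, ∑ c, χ c b * (χ a c * p a) = (if a = b then (Fintype.card α : ℝ) else 0) * p a := by
    intro a
    rw [← hχ.orth, Finset.sum_mul]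
    exact Finset.sum_congr rfl fun _ _ => by ring
  simp [h]

/-- Fidelities that are close to those of strictly positive error rates come from strictly positive
error rates, because the inverse Fourier transform is continuous. -/
theorem eventually_exists_rates (hχ : IsFourierKernel χ o) {p : α → ℝ} (hp : ∀ a, 0 < p a)
    (w : α → ℝ) :
    ∀ᶠ η in nhds (1 : ℝ), ∃ q : α → ℝ, (∀ a, 0 < q a) ∧
      ∀ b, fourier χ q b = η ^ w b * fourier χ p b := by
  have hN := hχ.card_ne_zero
  have hcont : ∀ a, ∀ᶠ η in nhds (1 : ℝ),
      0 < fourier χ (fun b => η ^ w b * fourier χ p b) a / Fintype.card α := by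
    intro a
    have hc : ContinuousAt
        (fun η : ℝ => fourier χ (fun b => η ^ w b * fourier χ p b) a / Fintype.card α) 1 := by
      unfold fourier
      refine ContinuousAt.div_const (tendsto_finsetSum _ fun b _ => ?_) _
      exact ((Real.continuousAt_rpow_const 1 (w b) (Or.inl one_ne_zero)).mul_const _).const_mul _
    refine hc.eventually (lt_mem_nhds ?_)
    simp only [Real.one_rpow, one_mul]
    change 0 < fourier χ (fourier χ p) a / _
    rw [hχ.fourier_fourier, mul_div_cancel_left₀ _ hN]
    exact hp a
  filter_upwards [Filter.eventually_all.mpr hcont] with η hη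
  refine ⟨_, hη, fun b => ?_⟩
  have h := hχ.fourier_fourier (fun b => η ^ w b * fourier χ p b) b
  rw [fourier] at h ⊢
  simp only [mul_div_assoc', ← Finset.sum_div, h]
  field_simp

/-- The depolarizing error rates, a mixture of no error and a uniformly random error. -/
theorem exists_depolarizing (hχ : IsFourierKernel χ o) :
    ∃ p : α → ℝ, (∀ a, 0 < p a) ∧ ∑ a, p a = 1 ∧ ∀ b, 0 < fourier χ p b ∧
      fourier χ p b = if b = o then 1 else 1 / 2 := by
  have hN := hχ.card_ne_zero
  have hN0 : (0 : ℝ) < Fintype.card α := lt_of_le_of_ne (Nat.cast_nonneg _) hN.symm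
  have key : ∀ b, fourier χ (fun a => (if a = o then 1 / 2 else 0) + 1 / 2 / Fintype.card α) b =
      if b = o then 1 else 1 / 2 := by
    intro b
    have h1 : ∑ a, χ a b = if b = o then (Fintype.card α : ℝ) else 0 := by
      rw [← hχ.orth]
      exact Finset.sum_congr rfl fun a _ => by rw [hχ.base, mul_one, hχ.symm]
    simp only [fourier, mul_add, Finset.sum_add_distrib, ← Finset.sum_mul, h1]
    simp only [mul_ite, mul_zero, Finset.sum_ite_eq', Finset.mem_univ, if_true, hχ.symm o,
      hχ.base]
    split_ifs
    · field_simp; norm_num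
    · norm_num
  refine ⟨_, fun a => ?_, ?_, fun b => ⟨?_, key b⟩⟩
  · split_ifs <;> positivity
  · rw [← hχ.fourier_base, key, if_pos rfl]
  · rw [key]; split_ifs <;> norm_num

end IsFourierKernel

theorem sgn_zero : sgn 0 = 1 := by simp [sgn]

theorem sgn_one : sgn 1 = -1 := by
  have h1 : (1 : ZMod 2).val = 1 := rfl
  simp [sgn, h1]

theorem bit_cases (s : ZMod 2) : s = 0 ∨ s = 1 := by revert s; decide

theorem sum_bit {M : Type*} [AddCommMonoid M] (f : ZMod 2 → M) : ∑ s, f s = f 0 + f 1 :=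
  Fin.sum_univ_two f

theorem Pauli1.sum_eq {M : Type*} [AddCommMonoid M] (f : Pauli1 → M) :
    ∑ P, f P = f .I + (f .X + (f .Y + f .Z)) := by
  have : (Finset.univ : Finset Pauli1) = {.I, .X, .Y, .Z} := rfl
  rw [this, Finset.sum_insert (by decide), Finset.sum_insert (by decide),
    Finset.sum_insert (by decide), Finset.sum_singleton]

theorem isFourierKernel_bit : IsFourierKernel (fun s t : ZMod 2 => sgn (s * t)) 0 where
  symm a b := by rw [mul_comm]
  base a := by simp [sgn_zero]
  orth a b := by
    rcases bit_cases a with rfl | rfl <;> rcases bit_cases b with rfl | rfl <;>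
      simp [sum_bit, sgn_zero, sgn_one, one_add_one_eq_two]

theorem isFourierKernel_pauli1 :
    IsFourierKernel (fun P Q : Pauli1 => sgn (P.inner Q)) .I where
  symm a b := by cases a <;> cases b <;> rfl
  base a := by simp [Pauli1.inner, sgn_zero]
  orth a b := by
    have hcard : Fintype.card Pauli1 = 4 := rfl
    cases a <;> cases b <;>
      simp [Pauli1.sum_eq, Pauli1.inner, sgn_zero, sgn_one, hcard] <;> norm_num

theorem isFourierKernel_bits {ι : Type} [Fintype ι] [DecidableEq ι] :
    IsFourierKernel (fun a x : Bits ι => sgn (a ⬝ᵥ x)) 0 := by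
  simp only [dotProduct, sgn_sum]
  exact isFourierKernel_bit.pi (ι := ι)

theorem isFourierKernel_pauli {ι : Type} [Fintype ι] [DecidableEq ι] :
    IsFourierKernel (fun P Q : PauliString ι => sgn (pauliInner P Q)) (fun _ => .I) := by
  simpa only [pauliInner, sgn_sum] using isFourierKernel_pauli1.pi (ι := ι)

theorem isFourierKernel_mcm {m n : ℕ} :
    IsFourierKernel (fun c e : Edge m n =>
      sgn (c.1 ⬝ᵥ e.1) * (sgn (c.2.1 ⬝ᵥ e.2.1) * sgn (pauliInner c.2.2 e.2.2)))
      (0, 0, fun _ => .I) :=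
  isFourierKernel_bits.prod (isFourierKernel_bits.prod isFourierKernel_pauli)

theorem pauliFidelity_eq_fourier {ι : Type} [Fintype ι] [DecidableEq ι] (p : PauliString ι → ℝ) :
    pauliFidelity p = fourier (fun P Q => sgn (pauliInner P Q)) p := rfl

theorem mcmFidelity_eq_fourier {m n : ℕ}
    (p : Bits (Fin n) → Bits (Fin n) → PauliString (Fin m) → ℝ) (x y : Bits (Fin n))
    (Q : PauliString (Fin m)) :
    mcmFidelity p x y Q = fourier (fun c e : Edge m n =>
      sgn (c.1 ⬝ᵥ e.1) * (sgn (c.2.1 ⬝ᵥ e.2.1) * sgn (pauliInner c.2.2 e.2.2)))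
      (fun c => p c.1 c.2.1 c.2.2) (x, y, Q) := by
  simp only [mcmFidelity, fourier, Fintype.sum_prod_type, sgn_add, mul_assoc]

/-! ### The Pauli basis -/

section Tensor

variable {ι : Type} [Fintype ι] [DecidableEq ι]

omit [DecidableEq ι] in
theorem tensor_conjTranspose (u : ι → Matrix (ZMod 2) (ZMod 2) ℂ) :
    (tensor u)ᴴ = tensor fun i => (u i)ᴴ := by
  ext s t
  simp [tensor, Matrix.conjTranspose_apply]

theorem trace_tensor (u : ι → Matrix (ZMod 2) (ZMod 2) ℂ) :
    (tensor u).trace = ∏ i, (u i).trace := by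
  simp only [Matrix.trace, Matrix.diag, tensor, Matrix.of_apply]
  rw [Finset.prod_univ_sum, Fintype.piFinset_univ]

omit [DecidableEq ι] in
theorem tensor_one : tensor (fun _ : ι => (1 : Matrix (ZMod 2) (ZMod 2) ℂ)) = 1 := by
  ext s t
  by_cases h : s = t
  · subst h
    simp [tensor]
  · obtain ⟨i, hi⟩ := Function.ne_iff.mp h
    rw [Matrix.one_apply_ne h]
    exact Finset.prod_eq_zero (Finset.mem_univ i) (Matrix.one_apply_ne hi)

end Tensor

theorem Pauli1.mat_I : Pauli1.I.mat = 1 := by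
  ext s t
  simp [Pauli1.mat, Matrix.one_apply]

theorem Pauli1.mat_conjTranspose (P : Pauli1) : P.matᴴ = P.mat := by
  ext s t
  rcases bit_cases s with rfl | rfl <;> rcases bit_cases t with rfl | rfl <;> cases P <;>
    simp [Pauli1.mat, Matrix.conjTranspose_apply]

theorem Pauli1.mat_mul_self (P : Pauli1) : P.mat * P.mat = 1 := by
  ext s t
  rcases bit_cases s with rfl | rfl <;> rcases bit_cases t with rfl | rfl <;> cases P <;>
    simp [Pauli1.mat, Matrix.mul_apply, sum_bit]

theorem Pauli1.trace_mat (P : Pauli1) : P.mat.trace = if P = .I then 2 else 0 := by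
  cases P <;> simp [Pauli1.mat, Matrix.trace, sum_bit]

theorem Pauli1.trace_mat_mul (P Q : Pauli1) : (P.mat * Q.mat).trace = if P = Q then 2 else 0 := by
  cases P <;> cases Q <;>
    simp [Pauli1.mat, Matrix.trace, Matrix.mul_apply, sum_bit, one_add_one_eq_two]

theorem Pauli1.sum_mat_apply_mul (s t u v : ZMod 2) :
    ∑ P : Pauli1, P.mat s t * P.mat u v = if s = v ∧ t = u then 2 else 0 := by
  rcases bit_cases s with rfl | rfl <;> rcases bit_cases t with rfl | rfl <;>
    rcases bit_cases u with rfl | rfl <;> rcases bit_cases v with rfl | rfl <;>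
    simp [Pauli1.mat, Pauli1.sum_eq] <;> norm_num

section Pauli

variable {ι : Type} [Fintype ι] [DecidableEq ι]

omit [DecidableEq ι] in
theorem pauliMat_one : pauliMat (fun _ : ι => .I) = 1 := by
  simp only [pauliMat, Pauli1.mat_I, tensor_one]

omit [DecidableEq ι] in
theorem pauliMat_conjTranspose (P : PauliString ι) : (pauliMat P)ᴴ = pauliMat P := by
  simp only [pauliMat, tensor_conjTranspose, Pauli1.mat_conjTranspose]

theorem pauliMat_mul_self (P : PauliString ι) : pauliMat P * pauliMat P = 1 := by
  simp only [pauliMat, tensor_mul, Pauli1.mat_mul_self, tensor_one]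

theorem trace_pauliMat_mul (P Q : PauliString ι) :
    (pauliMat P * pauliMat Q).trace = if P = Q then 2 ^ Fintype.card ι else 0 := by
  simp only [pauliMat, tensor_mul, trace_tensor, Pauli1.trace_mat_mul]
  by_cases h : P = Q
  · simp [h]
  · obtain ⟨i, hi⟩ := Function.ne_iff.mp h
    rw [if_neg h]
    exact Finset.prod_eq_zero (Finset.mem_univ i) (if_neg hi)

theorem sum_pauliMat_apply_mul (s t u v : Bits ι) :
    ∑ P : PauliString ι, pauliMat P s t * pauliMat P u v =
      if s = v ∧ t = u then 2 ^ Fintype.card ι else 0 := by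
  have h : ∑ P : PauliString ι, pauliMat P s t * pauliMat P u v =
      ∏ i, ∑ P : Pauli1, P.mat (s i) (t i) * P.mat (u i) (v i) := by
    rw [Finset.prod_univ_sum, Fintype.piFinset_univ]
    simp only [Finset.prod_mul_distrib]
    rfl
  simp only [h, Pauli1.sum_mat_apply_mul]
  split_ifs with hst
  · simp [hst.1, hst.2]
  · have : ∃ i, ¬ (s i = v i ∧ t i = u i) := by
      by_contra! hall
      exact hst ⟨funext fun i => (hall i).1, funext fun i => (hall i).2⟩
    obtain ⟨i, hi⟩ := this
    exact Finset.prod_eq_zero (Finset.mem_univ i) (if_neg hi)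

/-- The Pauli expansion of an operator. -/
theorem sum_trace_smul_pauliMat (A : Operator ι) :
    ∑ P : PauliString ι, (pauliMat P * A).trace • pauliMat P =
      (2 ^ Fintype.card ι : ℂ) • A := by
  ext s t
  simp only [Matrix.sum_apply, Matrix.smul_apply, smul_eq_mul, Matrix.trace, Matrix.diag,
    Matrix.mul_apply, Finset.sum_mul]
  rw [Finset.sum_comm]
  have h : ∀ u, ∑ P : PauliString ι, ∑ v, pauliMat P u v * A v u * pauliMat P s t =
      ∑ v, (if u = t ∧ v = s then 2 ^ Fintype.card ι else 0) * A v u := by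
    intro u
    rw [Finset.sum_comm]
    refine Finset.sum_congr rfl fun v _ => ?_
    rw [← sum_pauliMat_apply_mul, Finset.sum_mul]
    exact Finset.sum_congr rfl fun P _ => by ring
  simp [h, ite_and]

theorem eq_of_trace_pauliMat_mul {A B : Operator ι}
    (h : ∀ P : PauliString ι, (pauliMat P * A).trace = (pauliMat P * B).trace) : A = B := by
  have h2 : (2 ^ Fintype.card ι : ℂ) ≠ 0 := by positivity
  refine smul_right_injective _ h2 ?_
  simp only [← sum_trace_smul_pauliMat, h]

theorem pauliMat_smul_injective {P Q : PauliString ι} {s : ℂ}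
    (h : pauliMat P = s • pauliMat Q) : P = Q := by
  by_contra hne
  have h1 := trace_pauliMat_mul P P
  rw [if_pos rfl] at h1
  nth_rewrite 2 [h] at h1
  rw [Matrix.mul_smul, Matrix.trace_smul, trace_pauliMat_mul, if_neg hne, smul_zero] at h1
  exact absurd h1.symm (by positivity)

/-! ### Channels in the Pauli basis -/

theorem pauliMat_conj (P Q : PauliString ι) :
    pauliMat P * pauliMat Q * pauliMat P = (sgn (pauliInner P Q) : ℂ) • pauliMat Q := by
  rw [pauliMat_mul_comm, Matrix.smul_mul, mul_assoc, pauliMat_mul_self, mul_one]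

theorem trace_pauliMat_mul_pauliChannel (p : PauliString ι → ℝ) (Q : PauliString ι)
    (A : Operator ι) :
    (pauliMat Q * pauliChannel p A).trace = pauliFidelity p Q * (pauliMat Q * A).trace := by
  have h : ∀ P : PauliString ι, (pauliMat Q * (pauliMat P * A * (pauliMat P)ᴴ)).trace =
      sgn (pauliInner P Q) * (pauliMat Q * A).trace := by
    intro P
    rw [pauliMat_conjTranspose, ← mul_assoc, Matrix.trace_mul_comm]
    simp only [← mul_assoc]
    rw [pauliMat_conj, Matrix.smul_mul, Matrix.trace_smul, smul_eq_mul]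
  simp only [pauliChannel, Finset.mul_sum, Matrix.mul_smul, Matrix.trace_sum, Matrix.trace_smul, h,
    pauliFidelity, Complex.ofReal_sum, Finset.sum_mul, Complex.ofReal_mul, smul_eq_mul]
  exact Finset.sum_congr rfl fun P _ => by ring

theorem star_trace_pauliMat_mul {A : Operator ι} (hA : A.IsHermitian) (P : PauliString ι) :
    star (pauliMat P * A).trace = (pauliMat P * A).trace := by
  rw [← Matrix.trace_conjTranspose, Matrix.conjTranspose_mul, hA, pauliMat_conjTranspose,
    Matrix.trace_mul_comm]

/-- The matrix identity `G† P G = ± G†(P)`, in terms of Pauli coefficients. -/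
theorem Clifford.exists_sign (G : Clifford ι) (P : PauliString ι) :
    ∃ s : ℝ, s ≠ 0 ∧ ∀ A : Operator ι,
      (pauliMat P * G.channel A).trace = s * (pauliMat (G.pullback P) * A).trace := by
  have key : ∀ A : Operator ι, (pauliMat P * G.channel A).trace =
      (G.Uᴴ * pauliMat P * G.U * A).trace := by
    intro A
    rw [Clifford.channel, ← mul_assoc, Matrix.trace_mul_comm]
    simp only [mul_assoc]
  have h : G.Uᴴ * pauliMat P * G.U = pauliMat (G.pullback P) ∨
      G.Uᴴ * pauliMat P * G.U = -pauliMat (G.pullback P) := (G.pull P).choose_spec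
  rcases h with h | h
  · exact ⟨1, one_ne_zero, fun A => by simp [key, h]⟩
  · exact ⟨-1, by norm_num, fun A => by simp [key, h]⟩

theorem Clifford.pullback_one (G : Clifford ι) : G.pullback (fun _ => .I) = fun _ => .I := by
  have h : G.Uᴴ * pauliMat (fun _ => .I) * G.U = pauliMat (G.pullback fun _ => .I) ∨
      G.Uᴴ * pauliMat (fun _ => .I) * G.U = -pauliMat (G.pullback fun _ => .I) :=
    (G.pull _).choose_spec
  have hU : G.Uᴴ * G.U = 1 := Matrix.mem_unitaryGroup_iff'.mp G.unitary
  rw [pauliMat_one, mul_one, hU, ← pauliMat_one] at h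
  rcases h with h | h
  · exact (pauliMat_smul_injective (s := 1) (by rw [one_smul]; exact h)).symm
  · exact (pauliMat_smul_injective (s := -1) (by rw [neg_smul, one_smul]; exact h)).symm

omit [Fintype ι] [DecidableEq ι] in
theorem pattern_one : pattern (fun _ : ι => Pauli1.I) = 0 := by
  ext i; simp [pattern]

omit [Fintype ι] [DecidableEq ι] in
theorem pattern_eq_iff {P Q : PauliString ι} :
    pattern P = pattern Q ↔ ∀ i, P i = .I ↔ Q i = .I := by
  simp only [funext_iff, pattern]
  refine forall_congr' fun i => ?_
  by_cases h1 : P i = .I <;> by_cases h2 : Q i = .I <;> simp [h1, h2]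

/-- Single-qubit unitaries preserve weight patterns: they fix the identity and preserve the space
of traceless matrices. -/
theorem trace_pauliMat_mul_localChannel_pauliMat (u : ι → Matrix.unitaryGroup (ZMod 2) ℂ)
    {P Q : PauliString ι} (h : pattern P ≠ pattern Q) :
    (pauliMat Q * localChannel u (pauliMat P)).trace = 0 := by
  simp only [localChannel, pauliMat, tensor_conjTranspose, tensor_mul, trace_tensor]
  rw [Ne, pattern_eq_iff] at h
  push Not at h
  obtain ⟨i, hi⟩ := h
  refine Finset.prod_eq_zero (Finset.mem_univ i) ?_
  have h1 : (u i : Matrix (ZMod 2) (ZMod 2) ℂ) * (u i : Matrix (ZMod 2) (ZMod 2) ℂ)ᴴ = 1 :=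
    Matrix.mem_unitaryGroup_iff.mp (u i).2
  have h2 : (u i : Matrix (ZMod 2) (ZMod 2) ℂ)ᴴ * (u i : Matrix (ZMod 2) (ZMod 2) ℂ) = 1 :=
    Matrix.mem_unitaryGroup_iff'.mp (u i).2
  rcases hi with ⟨hP, hQ⟩ | ⟨hP, hQ⟩
  · rw [hP, Pauli1.mat_I, mul_one, h1, mul_one, Pauli1.trace_mat, if_neg hQ]
  · rw [hQ, Pauli1.mat_I, one_mul, Matrix.trace_mul_comm, ← mul_assoc, h2, one_mul,
      Pauli1.trace_mat, if_neg hP]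

theorem Pauli1.exists_unitary {P Q : Pauli1} (h : P = .I ↔ Q = .I) :
    ∃ u : Matrix.unitaryGroup (ZMod 2) ℂ,
      (u : Matrix (ZMod 2) (ZMod 2) ℂ)ᴴ * Q.mat * (u : Matrix (ZMod 2) (ZMod 2) ℂ) = P.mat := by
  by_cases hPQ : P = Q
  · exact ⟨1, by simp [hPQ]⟩
  have hP : P ≠ .I := fun h1 => hPQ (h1.trans (h.mp h1).symm)
  have hQ : Q ≠ .I := fun h1 => hP (h.mpr h1)
  have hanti : P.mat * Q.mat = -(Q.mat * P.mat) := by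
    rw [Pauli1.mat_mul_comm, Pauli1.inner, if_neg (by simp [hP, hQ, hPQ]), sgn_one]
    simp
  -- The reflection `(P + Q) / √2` exchanges the anticommuting operators `P` and `Q`.
  let c : ℝ := (√2)⁻¹
  have hc : (c : ℂ) * c = 2⁻¹ := by
    have : c * c = 2⁻¹ := by rw [← mul_inv, Real.mul_self_sqrt (by norm_num)]
    rw [← Complex.ofReal_mul, this]
    simp
  have hherm : ((c : ℂ) • (P.mat + Q.mat))ᴴ = (c : ℂ) • (P.mat + Q.mat) := by
    rw [Matrix.conjTranspose_smul, Matrix.conjTranspose_add, P.mat_conjTranspose,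
      Q.mat_conjTranspose]
    simp
  have hPQP : Q.mat * P.mat = -(P.mat * Q.mat) := by rw [hanti, neg_neg]
  have hunit : (c : ℂ) • (P.mat + Q.mat) ∈ Matrix.unitaryGroup (ZMod 2) ℂ := by
    rw [Matrix.mem_unitaryGroup_iff, Matrix.star_eq_conjTranspose, hherm, Matrix.smul_mul,
      Matrix.mul_smul, smul_smul, hc, mul_add, add_mul, add_mul, P.mat_mul_self, Q.mat_mul_self,
      hPQP]
    rw [show (1 : Matrix (ZMod 2) (ZMod 2) ℂ) + -(P.mat * Q.mat) + (P.mat * Q.mat + 1) =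
      (2 : ℂ) • 1 by rw [two_smul]; abel, smul_smul]
    norm_num
  refine ⟨⟨_, hunit⟩, ?_⟩
  change ((c : ℂ) • (P.mat + Q.mat))ᴴ * Q.mat * ((c : ℂ) • (P.mat + Q.mat)) = P.mat
  rw [hherm, Matrix.smul_mul, Matrix.smul_mul, Matrix.mul_smul, smul_smul, hc, add_mul,
    Q.mat_mul_self, mul_add, add_mul, add_mul, one_mul, one_mul, mul_assoc P.mat Q.mat Q.mat,
    Q.mat_mul_self, mul_one, mul_assoc P.mat Q.mat P.mat, hPQP, mul_neg, ← mul_assoc,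
    P.mat_mul_self, one_mul]
  rw [show -Q.mat + P.mat + (P.mat + Q.mat) = (2 : ℂ) • P.mat by rw [two_smul]; abel, smul_smul]
  norm_num

/-- Pauli operators with the same weight pattern are related by single-qubit unitaries. -/
theorem exists_localChannel {P Q : PauliString ι} (h : pattern P = pattern Q) :
    ∃ u : ι → Matrix.unitaryGroup (ZMod 2) ℂ, ∀ A : Operator ι,
      (pauliMat Q * localChannel u A).trace = (pauliMat P * A).trace := by
  choose u hu using fun i => Pauli1.exists_unitary (pattern_eq_iff.mp h i)
  refine ⟨u, fun A => ?_⟩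
  rw [localChannel, ← mul_assoc, Matrix.trace_mul_comm]
  simp only [← mul_assoc]
  simp only [pauliMat, tensor_conjTranspose, tensor_mul, hu]

end Pauli

/-! ### Mid-circuit measurements in the Pauli basis -/

section Measurement

variable {m n : ℕ}

/-- The Pauli operator `Z ^ x`. -/
def zString {ι : Type} (x : Bits ι) : PauliString ι := fun i => if x i = 0 then .I else .Z

theorem pattern_zString {ι : Type} (x : Bits ι) : pattern (zString x) = x := by
  ext i
  rcases bit_cases (x i) with h | h <;> simp [pattern, zString, h]

theorem tensor_diagonal {ι : Type} [Fintype ι] [DecidableEq ι] (d : ι → ZMod 2 → ℂ) :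
    tensor (fun i => Matrix.diagonal (d i)) = Matrix.diagonal fun s => ∏ i, d i (s i) := by
  ext s t
  by_cases h : s = t
  · subst h
    simp [tensor]
  · obtain ⟨i, hi⟩ := Function.ne_iff.mp h
    rw [Matrix.diagonal_apply_ne _ h]
    exact Finset.prod_eq_zero (Finset.mem_univ i) (Matrix.diagonal_apply_ne _ hi)

theorem pauliMat_zString {ι : Type} [Fintype ι] [DecidableEq ι] (x : Bits ι) :
    pauliMat (zString x) = Matrix.diagonal fun s => (sgn (s ⬝ᵥ x) : ℂ) := by
  have h : ∀ i, (zString x i).mat = Matrix.diagonal fun s => (sgn (s * x i) : ℂ) := by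
    intro i
    ext s t
    rcases bit_cases s with rfl | rfl <;> rcases bit_cases t with rfl | rfl <;>
      rcases bit_cases (x i) with h | h <;> simp [zString, h, Pauli1.mat, sgn_zero, sgn_one]
  simp only [pauliMat, h, tensor_diagonal, dotProduct, sgn_sum, Complex.ofReal_prod]

/-- The tensor product of an operator on the unmeasured qubits and an operator on the ancillas. -/
def bipartite (M : Operator (Fin m)) (W : Operator (Fin n)) : Operator (Fin m ⊕ Fin n) :=
  Matrix.of fun s t => M (fun i => s (.inl i)) (fun i => t (.inl i)) *
    W (fun i => s (.inr i)) (fun i => t (.inr i))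

theorem bipartite_mul (M M' : Operator (Fin m)) (W W' : Operator (Fin n)) :
    bipartite M W * bipartite M' W' = bipartite (M * M') (W * W') := by
  ext s t
  simp only [bipartite, Matrix.mul_apply, Matrix.of_apply, Finset.sum_mul_sum]
  rw [← Fintype.sum_prod_type',
    ← (Equiv.sumArrowEquivProdArrow (Fin m) (Fin n) (ZMod 2)).sum_comp]
  exact Finset.sum_congr rfl fun r _ => mul_mul_mul_comm _ _ _ _

theorem bipartite_conjTranspose (M : Operator (Fin m)) (W : Operator (Fin n)) :
    (bipartite M W)ᴴ = bipartite Mᴴ Wᴴ := by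
  ext s t
  simp [bipartite, Matrix.conjTranspose_apply]

theorem pauliMat_sumElim (R : PauliString (Fin m)) (S : PauliString (Fin n)) :
    pauliMat (Sum.elim R S) = bipartite (pauliMat R) (pauliMat S) := by
  ext s t
  simp [pauliMat, tensor, bipartite, Fintype.prod_sum_type]

theorem mcmKraus_eq_bipartite (k a b : Bits (Fin n)) (P : PauliString (Fin m)) :
    mcmKraus k a b P = bipartite (pauliMat P) (Matrix.single (k + b) (k + a) 1) := by
  ext s t
  simp [mcmKraus, bipartite, Matrix.single_apply, eq_comm]

theorem mcmKraus_conj (k a b : Bits (Fin n)) (P R : PauliString (Fin m))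
    (S : PauliString (Fin n)) :
    (mcmKraus k a b P)ᴴ * pauliMat (Sum.elim R S) * mcmKraus k a b P =
      (sgn (pauliInner P R) * pauliMat S (k + b) (k + b) : ℂ) •
        bipartite (pauliMat R) (Matrix.single (k + a) (k + a) 1) := by
  rw [mcmKraus_eq_bipartite, pauliMat_sumElim, bipartite_conjTranspose, bipartite_mul,
    bipartite_mul, pauliMat_conjTranspose, pauliMat_conj, Matrix.conjTranspose_single,
    star_one, Matrix.single_mul_mul_single]
  ext s t
  simp only [bipartite, Matrix.single_apply, Matrix.smul_apply, Matrix.of_apply, smul_eq_mul]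
  split_ifs <;> ring

theorem sum_sgn_mul_sgn (s t : Bits (Fin n)) :
    ∑ x : Bits (Fin n), (sgn (x ⬝ᵥ s) : ℂ) * sgn (x ⬝ᵥ t) = if s = t then 2 ^ n else 0 := by
  have h := (isFourierKernel_bits (ι := Fin n)).orth s t
  have hcard : (Fintype.card (Bits (Fin n)) : ℝ) = 2 ^ n := by simp [ZMod.card]
  rw [hcard] at h
  have h' := congrArg Complex.ofReal h
  push_cast [apply_ite Complex.ofReal] at h'
  rw [← h']
  exact Finset.sum_congr rfl fun x _ => by rw [dotProduct_comm x s]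

theorem bipartite_single (R : PauliString (Fin m)) (s : Bits (Fin n)) :
    (2 ^ n : ℂ) • bipartite (pauliMat R) (Matrix.single s s 1) =
      ∑ x, (sgn (s ⬝ᵥ x) : ℂ) • pauliMat (withZ R x) := by
  have hw : ∀ x : Bits (Fin n), pauliMat (withZ R x) = bipartite (pauliMat R) (pauliMat (zString x)) :=
    fun x => pauliMat_sumElim R (zString x)
  ext t u
  simp only [hw, pauliMat_zString, Matrix.sum_apply, Matrix.smul_apply, bipartite, Matrix.of_apply,
    smul_eq_mul, Matrix.diagonal_apply, Matrix.single_apply]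
  by_cases htu : (fun i => t (.inr i)) = fun i => u (.inr i)
  · simp only [htu, if_true, and_self]
    have : ∀ x : Bits (Fin n), (sgn (s ⬝ᵥ x) : ℂ) * (pauliMat R (fun i => t (.inl i)) (fun i => u (.inl i)) *
        (sgn ((fun i => u (.inr i)) ⬝ᵥ x) : ℂ)) =
        pauliMat R (fun i => t (.inl i)) (fun i => u (.inl i)) *
        ((sgn (x ⬝ᵥ s) : ℂ) * sgn (x ⬝ᵥ fun i => u (.inr i))) := fun x => by
      rw [dotProduct_comm s, dotProduct_comm _ x]
      ring
    simp only [this, ← Finset.mul_sum, sum_sgn_mul_sgn]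
    split_ifs <;> ring
  · have : ¬ (s = (fun i => t (.inr i)) ∧ s = fun i => u (.inr i)) := fun h =>
      htu (h.1.symm.trans h.2)
    simp [htu, this]

theorem trace_pauliMat_mul_mcmBranch_eq (G : Clifford (Fin m ⊕ Fin n))
    (p : Bits (Fin n) → Bits (Fin n) → PauliString (Fin m) → ℝ) (k : Bits (Fin n))
    (A : Operator (Fin m ⊕ Fin n)) (R : PauliString (Fin m)) (S : PauliString (Fin n)) :
    2 ^ n * (pauliMat (Sum.elim R S) * mcmBranch G p k A).trace =
      ∑ a, ∑ b, ∑ P, (p a b P : ℂ) * (sgn (pauliInner P R) * pauliMat S (k + b) (k + b)) *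
        ∑ x, (sgn ((k + a) ⬝ᵥ x) : ℂ) * (pauliMat (withZ R x) * G.channel A).trace := by
  have h : ∀ a b P, 2 ^ n * (pauliMat (Sum.elim R S) *
      (mcmKraus k a b P * G.channel A * (mcmKraus k a b P)ᴴ)).trace =
      (sgn (pauliInner P R) * pauliMat S (k + b) (k + b)) *
        ∑ x, (sgn ((k + a) ⬝ᵥ x) : ℂ) * (pauliMat (withZ R x) * G.channel A).trace := by
    intro a b P
    rw [← mul_assoc (pauliMat _), Matrix.trace_mul_comm]
    simp only [← mul_assoc (mcmKraus k a b P)ᴴ, ← mul_assoc (pauliMat _)]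
    rw [mcmKraus_conj, Matrix.smul_mul, Matrix.trace_smul, smul_eq_mul,
      mul_left_comm, ← smul_eq_mul (2 ^ n : ℂ), ← Matrix.trace_smul, ← Matrix.smul_mul,
      bipartite_single, Finset.sum_mul, Matrix.trace_sum]
    simp only [Matrix.smul_mul, Matrix.trace_smul, smul_eq_mul]
  simp only [mcmBranch, Matrix.mul_sum, Matrix.mul_smul, Matrix.trace_sum, Matrix.trace_smul,
    smul_eq_mul]
  simp only [Finset.mul_sum (a := (2 ^ n : ℂ)), mul_left_comm (2 ^ n : ℂ), h]
  simp only [mul_assoc]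

/-- A Pauli operator that is not a power of `Z` on the ancillas has vanishing diagonal there, so
the post-measurement state has no such component. -/
theorem trace_pauliMat_mul_mcmBranch_eq_zero (G : Clifford (Fin m ⊕ Fin n))
    (p : Bits (Fin n) → Bits (Fin n) → PauliString (Fin m) → ℝ) (k : Bits (Fin n))
    (A : Operator (Fin m ⊕ Fin n)) {R : PauliString (Fin m)} {S : PauliString (Fin n)}
    (hS : ∀ y, S ≠ zString y) :
    (pauliMat (Sum.elim R S) * mcmBranch G p k A).trace = 0 := by
  obtain ⟨i, hI, hZ⟩ : ∃ i, S i ≠ .I ∧ S i ≠ .Z := by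
    by_contra! hall
    refine hS (pattern S) (funext fun i => ?_)
    by_cases hI : S i = .I
    · simp [zString, pattern, hI]
    · simp [zString, pattern, hall i hI]
  have hdiag : ∀ s, pauliMat S s s = 0 := fun s => by
    refine Finset.prod_eq_zero (Finset.mem_univ i) ?_
    have hXY : S i = .X ∨ S i = .Y := by
      revert hI hZ
      cases S i <;> simp
    rcases hXY with h | h <;> simp [h, Pauli1.mat]
  have h := trace_pauliMat_mul_mcmBranch_eq G p k A R S
  simp only [hdiag, mul_zero, zero_mul, Finset.sum_const_zero] at h
  exact (mul_eq_zero.mp h).resolve_left (by positivity)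

/-- The Pauli fidelities of the mid-circuit measurement are its matrix elements in the Pauli
basis. -/
theorem trace_withZ_mul_mcmBranch (G : Clifford (Fin m ⊕ Fin n))
    (p : Bits (Fin n) → Bits (Fin n) → PauliString (Fin m) → ℝ) (k : Bits (Fin n))
    (A : Operator (Fin m ⊕ Fin n)) (R : PauliString (Fin m)) (y : Bits (Fin n)) :
    2 ^ n * (pauliMat (withZ R y) * mcmBranch G p k A).trace =
      ∑ x, (sgn (k ⬝ᵥ x) * sgn (k ⬝ᵥ y) * mcmFidelity p x y R : ℂ) *
        (pauliMat (withZ R x) * G.channel A).trace := by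
  have h := trace_pauliMat_mul_mcmBranch_eq G p k A R (zString y)
  change 2 ^ n * (pauliMat (withZ R y) * mcmBranch G p k A).trace = _ at h
  rw [h]
  simp only [pauliMat_zString, Matrix.diagonal_apply_eq, add_dotProduct, sgn_add, mcmFidelity,
    Complex.ofReal_sum, Complex.ofReal_mul, Finset.mul_sum, Finset.sum_mul]
  conv_rhs =>
    rw [Finset.sum_comm]
    enter [2, a]
    rw [Finset.sum_comm]
    enter [2, b]
    rw [Finset.sum_comm]
  refine Finset.sum_congr rfl fun a _ => Finset.sum_congr rfl fun b _ =>
    Finset.sum_congr rfl fun P _ => Finset.sum_congr rfl fun x _ => ?_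
  ring

theorem sgn_mul_self (s : ZMod 2) : sgn s * sgn s = 1 := by
  rcases bit_cases s with rfl | rfl <;> simp [sgn_zero, sgn_one]

/-- A Fourier transform over the readouts isolates a single Pauli fidelity. -/
theorem sum_sgn_mul_trace_mcmBranch (G : Clifford (Fin m ⊕ Fin n))
    (p : Bits (Fin n) → Bits (Fin n) → PauliString (Fin m) → ℝ)
    (A : Operator (Fin m ⊕ Fin n)) (R : PauliString (Fin m)) (x y : Bits (Fin n)) :
    ∑ k, (sgn (k ⬝ᵥ x) * sgn (k ⬝ᵥ y) : ℂ) *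
        (pauliMat (withZ R y) * mcmBranch G p k A).trace =
      mcmFidelity p x y R * (pauliMat (withZ R x) * G.channel A).trace := by
  have h2 : (2 ^ n : ℂ) ≠ 0 := by positivity
  refine mul_left_cancel₀ h2 ?_
  have hy : ∀ k : Bits (Fin n), (sgn (k ⬝ᵥ y) : ℂ) * sgn (k ⬝ᵥ y) = 1 := fun k => by
    rw [← Complex.ofReal_mul, sgn_mul_self, Complex.ofReal_one]
  simp only [Finset.mul_sum (a := (2 ^ n : ℂ)), mul_left_comm (2 ^ n : ℂ),
    trace_withZ_mul_mcmBranch]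
  simp only [Finset.mul_sum]
  rw [Finset.sum_comm]
  have hz : ∀ z, ∑ k, (sgn (k ⬝ᵥ x) * sgn (k ⬝ᵥ y) : ℂ) *
      ((sgn (k ⬝ᵥ z) * sgn (k ⬝ᵥ y) * mcmFidelity p z y R : ℂ) *
        (pauliMat (withZ R z) * G.channel A).trace) =
      (if x = z then 2 ^ n else 0) *
        (mcmFidelity p z y R * (pauliMat (withZ R z) * G.channel A).trace) := by
    intro z
    rw [← sum_sgn_mul_sgn, Finset.sum_mul]
    refine Finset.sum_congr rfl fun k _ => ?_
    linear_combination (sgn (k ⬝ᵥ x) * sgn (k ⬝ᵥ z) * (mcmFidelity p z y R *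
      (pauliMat (withZ R z) * G.channel A).trace) : ℂ) * hy k
  simp only [hz, ite_mul, zero_mul, Finset.sum_ite_eq, Finset.mem_univ, if_true]
  ring

end Measurement

/-! ### The gauge map -/

section GaugeMap

variable {m n : ℕ}

theorem trace_pauliMat_mul_gaugeMap (η : ℝ) (ν : Bits (Fin m ⊕ Fin n) → ℝ)
    (Q : PauliString (Fin m ⊕ Fin n)) (A : Operator (Fin m ⊕ Fin n)) :
    (pauliMat Q * gaugeMap η ν A).trace =
      (η ^ (ν (pattern Q) - ν 0) : ℝ) * (pauliMat Q * A).trace := by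
  have hcard : Fintype.card (Fin m ⊕ Fin n) = m + n := by simp
  simp only [gaugeMap, Matrix.mul_sum, Matrix.mul_smul, Matrix.trace_sum, Matrix.trace_smul,
    trace_pauliMat_mul, hcard, smul_eq_mul, mul_ite, mul_zero, Finset.sum_ite_eq,
    Finset.mem_univ, if_true]
  field_simp

theorem gaugeMap_neg_gaugeMap {η : ℝ} (hη : 0 < η) (ν : Bits (Fin m ⊕ Fin n) → ℝ)
    (A : Operator (Fin m ⊕ Fin n)) : gaugeMap η (-ν) (gaugeMap η ν A) = A := by
  refine eq_of_trace_pauliMat_mul fun Q => ?_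
  rw [trace_pauliMat_mul_gaugeMap, trace_pauliMat_mul_gaugeMap, ← mul_assoc, ← Complex.ofReal_mul,
    ← Real.rpow_add hη, Pi.neg_apply, Pi.neg_apply]
  simp

theorem two_pow_mul_trace_localChannel {ι : Type} [Fintype ι] [DecidableEq ι]
    (u : ι → Matrix.unitaryGroup (ZMod 2) ℂ) (Q : PauliString ι) (A : Operator ι) :
    2 ^ Fintype.card ι * (pauliMat Q * localChannel u A).trace =
      ∑ P, (pauliMat P * A).trace * (pauliMat Q * localChannel u (pauliMat P)).trace := by
  have h : (2 ^ Fintype.card ι : ℂ) • localChannel u A =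
      ∑ P, (pauliMat P * A).trace • localChannel u (pauliMat P) := by
    simp only [localChannel]
    rw [← Matrix.smul_mul, ← Matrix.mul_smul, ← sum_trace_smul_pauliMat, Matrix.mul_sum,
      Matrix.sum_mul]
    simp only [Matrix.smul_mul, Matrix.mul_smul]
  rw [← smul_eq_mul, ← Matrix.trace_smul, ← Matrix.mul_smul, h, Matrix.mul_sum, Matrix.trace_sum]
  simp only [Matrix.mul_smul, Matrix.trace_smul, smul_eq_mul]

theorem localChannel_gaugeMap (η : ℝ) (ν : Bits (Fin m ⊕ Fin n) → ℝ)
    (u : Fin m ⊕ Fin n → Matrix.unitaryGroup (ZMod 2) ℂ) (A : Operator (Fin m ⊕ Fin n)) :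
    localChannel u (gaugeMap η ν A) = gaugeMap η ν (localChannel u A) := by
  refine eq_of_trace_pauliMat_mul fun Q => ?_
  have h2 : (2 ^ Fintype.card (Fin m ⊕ Fin n) : ℂ) ≠ 0 := by positivity
  refine mul_left_cancel₀ h2 ?_
  rw [two_pow_mul_trace_localChannel, trace_pauliMat_mul_gaugeMap, mul_left_comm,
    two_pow_mul_trace_localChannel, Finset.mul_sum]
  refine Finset.sum_congr rfl fun P _ => ?_
  by_cases hPQ : pattern P = pattern Q
  · rw [trace_pauliMat_mul_gaugeMap, hPQ, mul_assoc]
  · rw [trace_pauliMat_mul_localChannel_pauliMat u hPQ, mul_zero, mul_zero, mul_zero]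

theorem trace_pauliMat_mul_channel_gaugeMap (G : Clifford (Fin m ⊕ Fin n)) (η : ℝ)
    (ν : Bits (Fin m ⊕ Fin n) → ℝ) (Q : PauliString (Fin m ⊕ Fin n))
    (A : Operator (Fin m ⊕ Fin n)) :
    (pauliMat Q * G.channel (gaugeMap η ν A)).trace =
      (η ^ (ν (pattern (G.pullback Q)) - ν 0) : ℝ) * (pauliMat Q * G.channel A).trace := by
  obtain ⟨s, -, hs⟩ := G.exists_sign Q
  rw [hs, hs, trace_pauliMat_mul_gaugeMap, mul_left_comm]

theorem gaugeMap_isHermitian (η : ℝ) (ν : Bits (Fin m ⊕ Fin n) → ℝ)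
    {A : Operator (Fin m ⊕ Fin n)} (hA : A.IsHermitian) : (gaugeMap η ν A).IsHermitian := by
  rw [Matrix.IsHermitian, gaugeMap, Matrix.conjTranspose_sum]
  refine Finset.sum_congr rfl fun P _ => ?_
  rw [Matrix.conjTranspose_smul, pauliMat_conjTranspose]
  congr 1
  simp only [star_mul', star_div₀, star_trace_pauliMat_mul hA, star_pow, star_ofNat]
  simp

theorem gaugeMap_one (ν : Bits (Fin m ⊕ Fin n) → ℝ) (A : Operator (Fin m ⊕ Fin n)) :
    gaugeMap 1 ν A = A :=
  eq_of_trace_pauliMat_mul fun Q => by simp [trace_pauliMat_mul_gaugeMap]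

theorem continuousAt_gaugeMap (ν : Bits (Fin m ⊕ Fin n) → ℝ) (A : Operator (Fin m ⊕ Fin n)) :
    ContinuousAt (fun η => gaugeMap η ν A) 1 := by
  unfold gaugeMap
  refine tendsto_finsetSum _ fun P _ => Filter.Tendsto.smul_const (ContinuousAt.mul ?_ continuousAt_const) _
  exact Complex.continuous_ofReal.continuousAt.comp
    (Real.continuousAt_rpow_const 1 _ (Or.inl one_ne_zero))

/-- Positive definiteness is an open condition on Hermitian matrices, by compactness of the unit
sphere. -/
theorem eventually_posDef {ι X : Type*} [Fintype ι] [TopologicalSpace X] {M : X → Matrix ι ι ℂ}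
    {x₀ : X} (hM : ContinuousAt M x₀) (hherm : ∀ x, (M x).IsHermitian) (h : (M x₀).PosDef) :
    ∀ᶠ x in nhds x₀, (M x).PosDef := by
  have hK : ∀ᶠ x in nhds x₀, ∀ v ∈ Metric.sphere (0 : ι → ℂ) 1, 0 < (star v ⬝ᵥ M x *ᵥ v).re := by
    refine (isCompact_sphere (0 : ι → ℂ) 1).eventually_forall_of_forall_eventually fun v hv => ?_
    have hentry : ∀ i j, ContinuousAt (fun z : X × (ι → ℂ) => M z.1 i j) (x₀, v) := fun i j =>
      ContinuousAt.comp (x := (x₀, v)) (f := Prod.fst)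
        ((continuous_apply_apply i j).continuousAt.comp hM) continuousAt_fst
    have hc : ContinuousAt (fun z : X × (ι → ℂ) => (star z.2 ⬝ᵥ M z.1 *ᵥ z.2).re) (x₀, v) := by
      refine Complex.continuous_re.continuousAt.comp ?_
      refine tendsto_finsetSum _ fun i _ => ContinuousAt.mul (by fun_prop) ?_
      exact tendsto_finsetSum _ fun j _ => ContinuousAt.mul (hentry i j) (by fun_prop)
    refine hc.eventually (lt_mem_nhds ?_)
    have hv0 : v ≠ 0 := by rintro rfl; simp at hv
    exact (Complex.pos_iff.mp (h.dotProduct_mulVec_pos hv0)).1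
  filter_upwards [hK] with x hx
  refine Matrix.PosDef.of_dotProduct_mulVec_pos (hherm x) fun v hv => ?_
  have hn : 0 < ‖v‖ := norm_pos_iff.mpr hv
  have h1 := hx (((‖v‖⁻¹ : ℝ) : ℂ) • v) (by simp [norm_smul, hn.ne'])
  rw [star_smul, Matrix.mulVec_smul, smul_dotProduct, dotProduct_smul, smul_eq_mul, smul_eq_mul,
    ← mul_assoc, Complex.star_def, Complex.conj_ofReal, ← Complex.ofReal_mul,
    Complex.re_ofReal_mul] at h1
  refine Complex.pos_iff.mpr ⟨pos_of_mul_pos_right h1 (by positivity), ?_⟩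
  exact ((hherm x).im_star_dotProduct_mulVec_self v).symm

end GaugeMap

section Models

variable {m n : ℕ} {κ : Type*}

/-! ### Gauge transforms are indistinguishable -/

namespace IsGaugeTransform

variable {G : Clifford (Fin m ⊕ Fin n)} {gates : κ → Clifford (Fin m ⊕ Fin n)} {η : ℝ}
  {ν : Bits (Fin m ⊕ Fin n) → ℝ} {N N' : NoiseModel m n κ}

theorem applyGates_gaugeMap (h : IsGaugeTransform G gates η ν N N') (C : List (Gate m n κ))
    (A : Operator (Fin m ⊕ Fin n)) :
    N'.applyGates gates (gaugeMap η ν A) C = gaugeMap η ν (N.applyGates gates A C) := by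
  induction C generalizing A with
  | nil => rfl
  | cons g C ih =>
    have hg : N'.applyGate gates (gaugeMap η ν A) g = gaugeMap η ν (N.applyGate gates A g) := by
      cases g with
      | oneQubit u => simp only [NoiseModel.applyGate, localChannel_gaugeMap]
      | multiQubit i => simp only [NoiseModel.applyGate, h.multiQubit, h.left_inv]
    change N'.applyGates gates (N'.applyGate gates (gaugeMap η ν A) g) C = _
    rw [hg, ih]
    rfl

theorem run_gaugeMap (h : IsGaugeTransform G gates η ν N N')
    (rounds : List (Bits (Fin n) × List (Gate m n κ))) (A : Operator (Fin m ⊕ Fin n)) :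
    N'.run G gates (gaugeMap η ν A) rounds = gaugeMap η ν (N.run G gates A rounds) := by
  induction rounds generalizing A with
  | nil => rfl
  | cons r rounds ih =>
    change N'.run G gates (N'.applyGates gates (mcmBranch G N'.mcmRate r.1 (gaugeMap η ν A)) r.2)
      rounds = _
    rw [h.mcm, h.left_inv, h.applyGates_gaugeMap, ih]
    rfl

theorem indistinguishable (h : IsGaugeTransform G gates η ν N N') :
    Indistinguishable G gates N N' := by
  intro E k j
  simp only [outcomeProb]
  rw [h.state, h.applyGates_gaugeMap, h.run_gaugeMap, h.meas, h.left_inv]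

/-- Rescaling the fidelities along the cut vector `δ ν` realizes the gauge transformation. -/
theorem of_fidelity (hη : 0 < η) (state : N'.ρ = gaugeMap η ν N.ρ)
    (gate : ∀ i Q, pauliFidelity (N'.gateRate i) Q =
      η ^ (ν (pattern Q) - ν (pattern ((gates i).pullback Q))) * pauliFidelity (N.gateRate i) Q)
    (mcm : ∀ e : Edge m n, mcmFidelity N'.mcmRate e.1 e.2.1 e.2.2 =
      η ^ coboundary G ν e * mcmFidelity N.mcmRate e.1 e.2.1 e.2.2)
    (meas : ∀ Q, pauliFidelity N'.measRate Q =
      η ^ (-(ν (pattern Q) - ν 0)) * pauliFidelity N.measRate Q) :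
    IsGaugeTransform G gates η ν N N' where
  left_inv := gaugeMap_neg_gaugeMap hη ν
  right_inv A := by
    have h := gaugeMap_neg_gaugeMap hη (-ν) A
    rwa [neg_neg] at h
  state := state
  oneQubit u A := by
    have h := gaugeMap_neg_gaugeMap hη (-ν) A
    rw [neg_neg] at h
    rw [← localChannel_gaugeMap, h]
  multiQubit i A := by
    refine eq_of_trace_pauliMat_mul fun Q => ?_
    simp only [NoiseModel.noisyGate, trace_pauliMat_mul_gaugeMap,
      trace_pauliMat_mul_pauliChannel, trace_pauliMat_mul_channel_gaugeMap, gate, Pi.neg_apply]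
    have h : η ^ (ν (pattern Q) - ν (pattern ((gates i).pullback Q))) =
        η ^ (ν (pattern Q) - ν 0) * η ^ (-ν (pattern ((gates i).pullback Q)) - -ν 0) := by
      rw [← Real.rpow_add hη]
      congr 1
      ring
    rw [h]
    push_cast
    ring
  mcm k A := by
    refine eq_of_trace_pauliMat_mul fun Q => ?_
    rw [trace_pauliMat_mul_gaugeMap, ← Sum.elim_comp_inl_inr Q]
    by_cases hS : ∃ y, Q ∘ Sum.inr = zString y
    · obtain ⟨y, hy⟩ := hS
      rw [hy]
      change (pauliMat (withZ (Q ∘ Sum.inl) y) * _).trace =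
        (η ^ (ν (pattern (withZ (Q ∘ Sum.inl) y)) - ν 0) : ℝ) *
          (pauliMat (withZ (Q ∘ Sum.inl) y) * _).trace
      have h2 : (2 ^ n : ℂ) ≠ 0 := by positivity
      refine mul_left_cancel₀ h2 ?_
      rw [mul_left_comm, trace_withZ_mul_mcmBranch, trace_withZ_mul_mcmBranch, Finset.mul_sum]
      refine Finset.sum_congr rfl fun x _ => ?_
      rw [trace_pauliMat_mul_channel_gaugeMap, mcm (x, y, Q ∘ Sum.inl)]
      have h : η ^ coboundary G ν (x, y, Q ∘ Sum.inl) =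
          η ^ (ν (pattern (withZ (Q ∘ Sum.inl) y)) - ν 0) *
            η ^ ((-ν) (pattern (G.pullback (withZ (Q ∘ Sum.inl) x))) - (-ν) 0) := by
        rw [← Real.rpow_add hη]
        congr 1
        simp only [coboundary, LinearMap.pi_apply, LinearMap.sub_apply, LinearMap.proj_apply,
          edgeTgt, edgeSrc, Pi.neg_apply]
        ring
      rw [h]
      push_cast
      ring
    · push Not at hS
      rw [trace_pauliMat_mul_mcmBranch_eq_zero _ _ _ _ hS,
        trace_pauliMat_mul_mcmBranch_eq_zero _ _ _ _ hS, mul_zero]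
  meas A := by
    refine eq_of_trace_pauliMat_mul fun Q => ?_
    rw [trace_pauliMat_mul_pauliChannel, trace_pauliMat_mul_pauliChannel,
      trace_pauliMat_mul_gaugeMap, meas, Pi.neg_apply, Pi.neg_apply,
      show -(ν (pattern Q) - ν 0) = -ν (pattern Q) - -ν 0 by ring]
    push_cast
    ring

end IsGaugeTransform

theorem coboundary_apply (G : Clifford (Fin m ⊕ Fin n)) (ν : Bits (Fin m ⊕ Fin n) → ℝ)
    (e : Edge m n) : coboundary G ν e = ν (edgeTgt e) - ν (edgeSrc G e) := rfl

theorem withZ_one_zero : withZ (fun _ : Fin m => Pauli1.I) (0 : Bits (Fin n)) = fun _ => .I := by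
  funext i
  cases i <;> simp [withZ]

/-- The transform of a noise model with a faithful initial state is again a noise model when `η` is
close to `1`, as all positivity conditions are open. -/
theorem eventually_exists_gaugeTransform [Finite κ] (G : Clifford (Fin m ⊕ Fin n))
    (gates : κ → Clifford (Fin m ⊕ Fin n)) (ν : Bits (Fin m ⊕ Fin n) → ℝ) (N : NoiseModel m n κ)
    (hN : N.ρ.PosDef) :
    ∀ᶠ η in nhds (1 : ℝ), ∃ N' : NoiseModel m n κ, IsGaugeTransform G gates η ν N N' ∧
      ∀ e, logFidelity N' e = logFidelity N e + coboundary G ν e * Real.log η := by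
  have hρ : ∀ᶠ η in nhds (1 : ℝ), (gaugeMap η ν N.ρ).PosDef :=
    eventually_posDef (continuousAt_gaugeMap ν N.ρ)
      (fun η => gaugeMap_isHermitian η ν hN.isHermitian) (by rwa [gaugeMap_one])
  have hgate := Filter.eventually_all.mpr fun i =>
    isFourierKernel_pauli.eventually_exists_rates (N.gateRate_pos i)
      fun Q => ν (pattern Q) - ν (pattern ((gates i).pullback Q))
  have hmcm := isFourierKernel_mcm.eventually_exists_rates
    (p := fun c : Edge m n => N.mcmRate c.1 c.2.1 c.2.2) (fun c => N.mcmRate_pos _ _ _)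
    (coboundary G ν)
  have hmeas := isFourierKernel_pauli.eventually_exists_rates N.measRate_pos
    fun Q => -(ν (pattern Q) - ν 0)
  filter_upwards [hρ, hgate, hmcm, hmeas, lt_mem_nhds one_pos] with η hρ hgate hmcm hmeas hη
  choose g hg hg' using hgate
  obtain ⟨p, hp, hp'⟩ := hmcm
  obtain ⟨r, hr, hr'⟩ := hmeas
  have hg' : ∀ i Q, pauliFidelity (g i) Q =
      η ^ (ν (pattern Q) - ν (pattern ((gates i).pullback Q))) * pauliFidelity (N.gateRate i) Q :=
    hg'
  have hr' : ∀ Q, pauliFidelity r Q = η ^ (-(ν (pattern Q) - ν 0)) * pauliFidelity N.measRate Q :=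
    hr'
  have hp' : ∀ e : Edge m n, mcmFidelity (fun a b P => p (a, b, P)) e.1 e.2.1 e.2.2 =
      η ^ coboundary G ν e * mcmFidelity N.mcmRate e.1 e.2.1 e.2.2 := fun e => by
    rw [mcmFidelity_eq_fourier, mcmFidelity_eq_fourier]
    exact hp' e
  have hpow : ∀ w : ℝ, 0 < η ^ w := fun w => Real.rpow_pos_of_pos hη w
  let N' : NoiseModel m n κ :=
    { ρ := gaugeMap η ν N.ρ
      gateRate := g
      mcmRate := fun a b P => p (a, b, P)
      measRate := r
      ρ_pos := hρ.posSemidef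
      ρ_trace := by
        have h := trace_pauliMat_mul_gaugeMap η ν (fun _ => .I) N.ρ
        rw [pauliMat_one, one_mul, one_mul, pattern_one, sub_self, Real.rpow_zero, N.ρ_trace] at h
        simpa using h
      ρ_overlap := fun v => by
        obtain ⟨P, hP, h⟩ := N.ρ_overlap v
        refine ⟨P, hP, ?_⟩
        rw [trace_pauliMat_mul_gaugeMap]
        exact mul_ne_zero (Complex.ofReal_ne_zero.mpr (hpow _).ne') h
      gateRate_pos := hg
      gateRate_sum := fun i => by
        rw [← isFourierKernel_pauli.fourier_base, ← pauliFidelity_eq_fourier, hg',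
          Clifford.pullback_one, sub_self, Real.rpow_zero, one_mul, pauliFidelity_eq_fourier,
          isFourierKernel_pauli.fourier_base, N.gateRate_sum]
      gateFidelity_pos := fun i Q => by
        rw [hg']
        exact mul_pos (hpow _) (N.gateFidelity_pos i Q)
      mcmRate_pos := fun a b P => hp (a, b, P)
      mcmRate_sum := by
        have h := isFourierKernel_mcm.fourier_base p
        rw [Fintype.sum_prod_type] at h
        simp only [Fintype.sum_prod_type] at h
        rw [← h]
        have h0 := hp' (0, 0, fun _ => .I)
        rw [mcmFidelity_eq_fourier, mcmFidelity_eq_fourier] at h0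
        refine h0.trans ?_
        rw [isFourierKernel_mcm.fourier_base, coboundary_apply, edgeTgt, edgeSrc, withZ_one_zero,
          Clifford.pullback_one, sub_self, Real.rpow_zero, one_mul]
        simpa only [Fintype.sum_prod_type] using N.mcmRate_sum
      mcmFidelity_pos := fun x y Q => by
        rw [hp' (x, y, Q)]
        exact mul_pos (hpow _) (N.mcmFidelity_pos x y Q)
      measRate_pos := hr
      measRate_sum := by
        rw [← isFourierKernel_pauli.fourier_base, ← pauliFidelity_eq_fourier, hr',
          pattern_one, sub_self, neg_zero, Real.rpow_zero, one_mul, pauliFidelity_eq_fourier,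
          isFourierKernel_pauli.fourier_base, N.measRate_sum]
      measFidelity_pos := fun Q => by
        rw [hr']
        exact mul_pos (hpow _) (N.measFidelity_pos Q)
      measFidelity_symm := fun P Q hPQ => by
        rw [hr', hr', hPQ, N.measFidelity_symm P Q hPQ] }
  refine ⟨N', IsGaugeTransform.of_fidelity hη rfl hg' hp' hr', fun e => ?_⟩
  have h : logFidelity N' e =
      Real.log (η ^ coboundary G ν e * mcmFidelity N.mcmRate e.1 e.2.1 e.2.2) :=
    congrArg Real.log (hp' e)
  rw [h, Real.log_mul (hpow _).ne' (N.mcmFidelity_pos _ _ _).ne', Real.log_rpow hη, add_comm]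
  rfl

/-- A faithful initial state with depolarizing noise is a noise model. -/
theorem exists_noiseModel_posDef (m n : ℕ) (κ : Type*) :
    ∃ N : NoiseModel m n κ, N.ρ.PosDef := by
  obtain ⟨p, hp, hp1, hpf⟩ :=
    (isFourierKernel_pauli (ι := Fin m ⊕ Fin n)).exists_depolarizing
  obtain ⟨q, hq, hq1, hqf⟩ := (isFourierKernel_mcm (m := m) (n := n)).exists_depolarizing
  let d : ZMod 2 → ℂ := fun s => if s = 0 then 3 / 4 else 1 / 4
  let ρ : Operator (Fin m ⊕ Fin n) := tensor fun _ => Matrix.diagonal d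
  have hd : ∀ s, 0 < d s := fun s => by
    rcases bit_cases s with rfl | rfl <;> simp [d]
  have hpd : ρ.PosDef := by
    simp only [ρ, tensor_diagonal]
    exact Matrix.PosDef.diagonal fun s => Finset.prod_pos fun i _ => hd _
  refine ⟨
    { ρ := ρ
      gateRate := fun _ => p
      mcmRate := fun a b P => q (a, b, P)
      measRate := p
      ρ_pos := hpd.posSemidef
      ρ_trace := by
        simp only [ρ, trace_tensor]
        refine Finset.prod_eq_one fun i _ => ?_
        rw [Matrix.trace_diagonal, sum_bit]
        norm_num [d]
      ρ_overlap := fun v => ?_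
      gateRate_pos := fun _ => hp
      gateRate_sum := fun _ => hp1
      gateFidelity_pos := fun _ Q => (hpf Q).1
      mcmRate_pos := fun a b P => hq (a, b, P)
      mcmRate_sum := by simpa only [Fintype.sum_prod_type] using hq1
      mcmFidelity_pos := fun x y Q => by
        rw [mcmFidelity_eq_fourier]
        exact (hqf (x, y, Q)).1
      measRate_pos := hp
      measRate_sum := hp1
      measFidelity_pos := fun Q => (hpf Q).1
      measFidelity_symm := fun P Q hPQ => ?_ }, hpd⟩
  · refine ⟨zString v, pattern_zString v, ?_⟩
    simp only [ρ, pauliMat, tensor_mul, trace_tensor]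
    refine Finset.prod_ne_zero_iff.mpr fun i _ => ?_
    rcases bit_cases (v i) with h | h <;>
      simp [zString, h, Pauli1.mat, Matrix.trace, sum_bit, d] <;> norm_num
  · have h : P = (fun _ => .I) ↔ Q = (fun _ => .I) := by
      simp only [funext_iff]
      exact forall_congr' (pattern_eq_iff.mp hPQ)
    rw [pauliFidelity_eq_fourier, (hpf P).2, (hpf Q).2]
    simp only [h]

/-! ### Learning fidelities from experiments -/

/-- The projections `(1 ± O) / 2` onto the eigenspaces of a Pauli operator. -/
theorem posSemidef_half_smul_one_add {ι : Type} [Fintype ι] [DecidableEq ι] (O : PauliString ι)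
    {s : ℂ} (hs : s * s = 1) (hs' : star s = s) :
    ((1 / 2 : ℂ) • (1 + s • pauliMat O)).PosSemidef := by
  have hherm : ((1 / 2 : ℂ) • (1 + s • pauliMat O))ᴴ = (1 / 2 : ℂ) • (1 + s • pauliMat O) := by
    rw [Matrix.conjTranspose_smul, Matrix.conjTranspose_add, Matrix.conjTranspose_smul,
      pauliMat_conjTranspose, Matrix.conjTranspose_one, hs']
    simp
  have hsq : ((1 / 2 : ℂ) • (1 + s • pauliMat O)) * ((1 / 2 : ℂ) • (1 + s • pauliMat O)) =
      (1 / 2 : ℂ) • (1 + s • pauliMat O) := by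
    rw [Matrix.smul_mul, Matrix.mul_smul, mul_add, add_mul, add_mul, one_mul, mul_one, one_mul,
      Matrix.smul_mul, Matrix.mul_smul, pauliMat_mul_self, smul_smul s s, hs, one_smul]
    module
  have h := Matrix.posSemidef_self_mul_conjTranspose ((1 / 2 : ℂ) • (1 + s • pauliMat O))
  rwa [hherm, hsq] at h

/-- The experiment whose terminating measurement is the two-outcome measurement of `O`. -/
noncomputable def pauliExperiment (O : PauliString (Fin m ⊕ Fin n)) (depth : ℕ) (first : List (Gate m n κ))
    (layer : Fin depth → List (Gate m n κ)) : Experiment m n κ where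
  depth := depth
  first := first
  layer := layer
  outcomes := 2
  povm := ![(1 / 2 : ℂ) • (1 + (1 : ℂ) • pauliMat O), (1 / 2 : ℂ) • (1 + (-1 : ℂ) • pauliMat O)]
  povm_pos := by
    refine Fin.forall_fin_two.mpr ⟨?_, ?_⟩
    · exact posSemidef_half_smul_one_add O (by norm_num) (by simp)
    · exact posSemidef_half_smul_one_add O (by norm_num) (by simp)
  povm_sum := by
    rw [Fin.sum_univ_two]
    change (1 / 2 : ℂ) • (1 + (1 : ℂ) • pauliMat O) + (1 / 2 : ℂ) • (1 + (-1 : ℂ) • pauliMat O) = 1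
    module

/-- Experiments determine the expectation value of a Pauli operator in the state before the
terminating measurement, damped by the fidelity of that measurement. -/
theorem Indistinguishable.expectation_eq {G : Clifford (Fin m ⊕ Fin n)}
    {gates : κ → Clifford (Fin m ⊕ Fin n)} {N₁ N₂ : NoiseModel m n κ}
    (h : Indistinguishable G gates N₁ N₂) (O : PauliString (Fin m ⊕ Fin n)) (depth : ℕ)
    (first : List (Gate m n κ)) (layer : Fin depth → List (Gate m n κ))
    (k : Fin depth → Bits (Fin n)) :
    pauliFidelity N₁.measRate O * (pauliMat O * N₁.run G gates (N₁.applyGates gates N₁.ρ first)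
        (List.ofFn fun i => (k i, layer i))).trace.re =
      pauliFidelity N₂.measRate O * (pauliMat O * N₂.run G gates
        (N₂.applyGates gates N₂.ρ first) (List.ofFn fun i => (k i, layer i))).trace.re := by
  let E : Experiment m n κ := pauliExperiment O depth first layer
  have hO : E.povm (0 : Fin 2) - E.povm (1 : Fin 2) = pauliMat O := by
    change (1 / 2 : ℂ) • (1 + (1 : ℂ) • pauliMat O) - (1 / 2 : ℂ) • (1 + (-1 : ℂ) • pauliMat O) = _
    module
  have hN : ∀ N : NoiseModel m n κ,
      outcomeProb G gates N E k (0 : Fin 2) - outcomeProb G gates N E k (1 : Fin 2) =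
        pauliFidelity N.measRate O * (pauliMat O * N.run G gates (N.applyGates gates N.ρ first)
          (List.ofFn fun i => (k i, layer i))).trace.re := by
    intro N
    rw [← Complex.re_ofReal_mul, ← trace_pauliMat_mul_pauliChannel, ← hO, Matrix.sub_mul,
      Matrix.trace_sub, Complex.sub_re]
    rfl
  rw [← hN, ← hN]
  exact congrArg₂ (· - ·) (h E k (0 : Fin 2)) (h E k (1 : Fin 2))

theorem trace_pauliMat_mul_re_ne_zero {ι : Type} [Fintype ι] [DecidableEq ι] {A : Operator ι}
    (hA : A.IsHermitian) {P : PauliString ι} (h : (pauliMat P * A).trace ≠ 0) :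
    (pauliMat P * A).trace.re ≠ 0 := fun h0 =>
  h (Complex.ext h0 (Complex.conj_eq_iff_im.mp (star_trace_pauliMat_mul hA P)))

/-- The experiment that prepares the initial state and measures `P` at once. -/
theorem Indistinguishable.state_eq {G : Clifford (Fin m ⊕ Fin n)}
    {gates : κ → Clifford (Fin m ⊕ Fin n)} {N₁ N₂ : NoiseModel m n κ}
    (h : Indistinguishable G gates N₁ N₂) (P : PauliString (Fin m ⊕ Fin n)) :
    pauliFidelity N₁.measRate P * (pauliMat P * N₁.ρ).trace.re =
      pauliFidelity N₂.measRate P * (pauliMat P * N₂.ρ).trace.re :=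
  h.expectation_eq P 0 [] Fin.elim0 Fin.elim0

/-- The experiments that rotate `P` to `± G†(Q ⊗ Z ^ x)`, perform one mid-circuit measurement and
measure `Q ⊗ Z ^ y`: after a Fourier transform over the readouts they yield the product of the
initial component, one fidelity of the mid-circuit measurement and one of the terminating
measurement. -/
theorem Indistinguishable.edge_eq {G : Clifford (Fin m ⊕ Fin n)}
    {gates : κ → Clifford (Fin m ⊕ Fin n)} {N₁ N₂ : NoiseModel m n κ}
    (h : Indistinguishable G gates N₁ N₂) {P : PauliString (Fin m ⊕ Fin n)} {e : Edge m n}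
    (hP : pattern P = edgeSrc G e) :
    pauliFidelity N₁.measRate (withZ e.2.2 e.2.1) *
        (mcmFidelity N₁.mcmRate e.1 e.2.1 e.2.2 * (pauliMat P * N₁.ρ).trace.re) =
      pauliFidelity N₂.measRate (withZ e.2.2 e.2.1) *
        (mcmFidelity N₂.mcmRate e.1 e.2.1 e.2.2 * (pauliMat P * N₂.ρ).trace.re) := by
  obtain ⟨x, y, Q⟩ := e
  obtain ⟨u, hu⟩ := exists_localChannel hP
  obtain ⟨s, hs, hsign⟩ := G.exists_sign (withZ Q x)
  have hk : ∀ k : Bits (Fin n),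
      pauliFidelity N₁.measRate (withZ Q y) *
        (pauliMat (withZ Q y) * mcmBranch G N₁.mcmRate k (localChannel u N₁.ρ)).trace.re =
      pauliFidelity N₂.measRate (withZ Q y) *
        (pauliMat (withZ Q y) * mcmBranch G N₂.mcmRate k (localChannel u N₂.ρ)).trace.re :=
    fun k => h.expectation_eq (withZ Q y) 1 [.oneQubit u] (fun _ => []) (fun _ => k)
  have hsum : ∀ N : NoiseModel m n κ, ∑ k, sgn (k ⬝ᵥ x) * sgn (k ⬝ᵥ y) *
      (pauliFidelity N.measRate (withZ Q y) *
        (pauliMat (withZ Q y) * mcmBranch G N.mcmRate k (localChannel u N.ρ)).trace.re) =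
      s * (pauliFidelity N.measRate (withZ Q y) *
        (mcmFidelity N.mcmRate x y Q * (pauliMat P * N.ρ).trace.re)) := by
    intro N
    have h1 := congrArg Complex.re
      (sum_sgn_mul_trace_mcmBranch G N.mcmRate (localChannel u N.ρ) Q x y)
    rw [hsign, hu, Complex.re_ofReal_mul, Complex.re_ofReal_mul, Complex.re_sum] at h1
    simp only [← Complex.ofReal_mul, Complex.re_ofReal_mul] at h1
    rw [mul_left_comm s, mul_left_comm s, ← h1, Finset.mul_sum]
    exact Finset.sum_congr rfl fun k _ => by ring
  refine mul_left_cancel₀ hs ?_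
  rw [← hsum, ← hsum]
  exact Finset.sum_congr rfl fun k _ => by rw [hk]

/-- The log fidelities of indistinguishable noise models differ by a cut vector, whose potential
compares the terminating measurements. -/
theorem Indistinguishable.exists_coboundary {G : Clifford (Fin m ⊕ Fin n)}
    {gates : κ → Clifford (Fin m ⊕ Fin n)} {N₁ N₂ : NoiseModel m n κ}
    (h : Indistinguishable G gates N₁ N₂) :
    ∃ w : Bits (Fin m ⊕ Fin n) → ℝ, ∀ e,
      logFidelity N₂ e - logFidelity N₁ e = coboundary G w e := by
  let L : NoiseModel m n κ → Bits (Fin m ⊕ Fin n) → ℝ := fun N v =>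
    Real.log (pauliFidelity N.measRate (zString v))
  have hL : ∀ N P, Real.log (pauliFidelity N.measRate P) = L N (pattern P) := fun N P =>
    congrArg Real.log (N.measFidelity_symm _ _ (pattern_zString _).symm)
  refine ⟨L N₁ - L N₂, fun e => ?_⟩
  obtain ⟨P, hP, hP₁⟩ := N₁.ρ_overlap (edgeSrc G e)
  have hr₁ := trace_pauliMat_mul_re_ne_zero N₁.ρ_pos.isHermitian hP₁
  have hstate := h.state_eq P
  have hedge := h.edge_eq hP
  have hr₂ : (pauliMat P * N₂.ρ).trace.re ≠ 0 := by
    intro h0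
    rw [h0, mul_zero] at hstate
    exact mul_ne_zero (N₁.measFidelity_pos P).ne' hr₁ hstate
  have hm := fun (N : NoiseModel m n κ) Q => (N.measFidelity_pos Q).ne'
  have hf := fun (N : NoiseModel m n κ) => (N.mcmFidelity_pos e.1 e.2.1 e.2.2).ne'
  have h1 := congrArg Real.log hstate
  have h2 := congrArg Real.log hedge
  rw [Real.log_mul (hm _ _) hr₁, Real.log_mul (hm _ _) hr₂, hL, hL, hP] at h1
  rw [Real.log_mul (hm _ _) (mul_ne_zero (hf _) hr₁), Real.log_mul (hm _ _)
    (mul_ne_zero (hf _) hr₂), Real.log_mul (hf _) hr₁, Real.log_mul (hf _) hr₂, hL, hL] at h2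
  simp only [coboundary_apply, Pi.sub_apply, logFidelity, edgeTgt]
  linarith

/-! ### Cycles and cuts -/

/-- The boundary and coboundary operators are adjoint. -/
theorem sum_mul_coboundary (G : Clifford (Fin m ⊕ Fin n)) (μ : Edge m n → ℝ)
    (ν : Bits (Fin m ⊕ Fin n) → ℝ) :
    ∑ e, μ e * coboundary G ν e = ∑ v, boundary G μ v * ν v := by
  have h : ∀ v, boundary G μ v * ν v =
      ∑ e, μ e * ((Pi.single (edgeTgt e) 1 : Bits (Fin m ⊕ Fin n) → ℝ) v * ν v -
        (Pi.single (edgeSrc G e) 1 : Bits (Fin m ⊕ Fin n) → ℝ) v * ν v) := by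
    intro v
    simp only [boundary, LinearMap.sum_apply, LinearMap.smulRight_apply, LinearMap.proj_apply,
      Finset.sum_apply, Pi.smul_apply, Pi.sub_apply, smul_eq_mul, Finset.sum_mul]
    exact Finset.sum_congr rfl fun e _ => by ring
  simp only [h]
  rw [Finset.sum_comm]
  refine Finset.sum_congr rfl fun e _ => ?_
  rw [← Finset.mul_sum, Finset.sum_sub_distrib, coboundary_apply]
  simp [Pi.single_apply]

theorem mem_cycleSpace_iff (G : Clifford (Fin m ⊕ Fin n)) (μ : Edge m n → ℝ) :
    μ ∈ cycleSpace G ↔ ∀ ν, ∑ e, μ e * coboundary G ν e = 0 := by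
  rw [cycleSpace, LinearMap.mem_ker]
  constructor
  · intro h ν
    simp [sum_mul_coboundary, h]
  · intro h
    funext v
    have := h (Pi.single v 1)
    rw [sum_mul_coboundary] at this
    simpa [Pi.single_apply] using this

theorem learnableChains_eq_cycleSpace [Finite κ] (G : Clifford (Fin m ⊕ Fin n))
    (gates : κ → Clifford (Fin m ⊕ Fin n)) :
    learnableChains G gates = (cycleSpace G : Set (Edge m n → ℝ)) := by
  ext μ
  rw [SetLike.mem_coe, mem_cycleSpace_iff]
  constructor
  · intro hμ ν
    obtain ⟨N, hN⟩ := exists_noiseModel_posDef m n κ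
    have hev := (eventually_exists_gaugeTransform G gates ν N hN).filter_mono
      (nhdsWithin_le_nhds (s := Set.Ioi 1))
    obtain ⟨η, ⟨N', hN', hlog⟩, hη⟩ := (hev.and self_mem_nhdsWithin).exists
    have h : chainValue μ N = chainValue μ N' := hμ N N' hN'.indistinguishable
    simp only [chainValue, hlog, mul_add, Finset.sum_add_distrib, ← mul_assoc,
      ← Finset.sum_mul] at h
    exact (mul_eq_zero.mp (left_eq_add.mp h)).resolve_right (Real.log_pos hη).ne'
  · intro hμ N₁ N₂ h
    obtain ⟨w, hw⟩ := h.exists_coboundary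
    have h0 := hμ w
    simp only [← hw, mul_sub, Finset.sum_sub_distrib] at h0
    exact (sub_eq_zero.mp h0).symm

end Models

end MCM

open MCM in
theorem theorem2 (m n : ℕ) (κ : Type*) [Finite κ]
    (G : Clifford (Fin m ⊕ Fin n)) (gates : κ → Clifford (Fin m ⊕ Fin n)) :
    -- the learnable chains are exactly the cycles
    learnableChains G gates = (cycleSpace G : Set (Edge m n → ℝ)) ∧
    -- every cut vector `δ ν` gives a gauge transformation to an indistinguishable noise model
    (∀ (ν : Bits (Fin m ⊕ Fin n) → ℝ) (N : NoiseModel m n κ), N.ρ.PosDef →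
      ∀ᶠ η in nhds (1 : ℝ), ∃ N' : NoiseModel m n κ,
        IsGaugeTransform G gates η ν N N' ∧
        Indistinguishable G gates N N' ∧
        ∀ e, logFidelity N' e = logFidelity N e + coboundary G ν e * Real.log η) ∧
    -- the learnable chains are orthogonal to the cut space
    (∀ μ ∈ learnableChains G gates, ∀ c ∈ cutSpace G, ∑ e, μ e * c e = 0) := by
  refine ⟨learnableChains_eq_cycleSpace G gates, fun ν N hN => ?_, ?_⟩
  · filter_upwards [eventually_exists_gaugeTransform G gates ν N hN] with η ⟨N', hN', hlog⟩
    exact ⟨N', hN', hN'.indistinguishable, hlog⟩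
  · rintro μ hμ c ⟨ν, rfl⟩
    rw [learnableChains_eq_cycleSpace] at hμ
    exact (mem_cycleSpace_iff G μ).mp hμ ν
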